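/- Let $X_1,\dots,X_k$ be smooth, pointwise linearly independent vector fields on $M=\mathbb R^n$ (a global orthonormal frame of a sub-Riemannian structure), let $u\in L^\infty([t_0,t_1],\mathbb R^k)$ with $t_0<t_1$, and let $q:[t_0,t_1]\to M$ satisfy $\dot q=\sum_i u_i(t)X_i(q)$ almost everywhere (a sub-Riemannian trajectory). **Notation.** Fix a basis of $T^*_{q(t_0)}M$, i.e. a linear isomorphism $L_0:T_{q(t_0)}M\to\mathbb R^n$. Let the linear maps $\Phi_1(t):T_{q(t)}M\to\mathbb R^n$ and the symmetric bilinear maps $\Phi_2(t):T_{q(t)}M\times T_{q(t)}M\to\mathbb R^n$ solve, for all $b$, $$\dot\Phi_1[b]+\sum_i u_i\,\Phi_1[D_{q(t)}X_i[b]]=0,\quad \Phi_1(t_0)=L_0,$$ $$\dot\Phi_2[b,b]+\sum_i u_i\{\Phi_1[D^2_{q(t)}X_i[b,b]]+2\Phi_2[D_{q(t)}X_i[b],b]\}=0,\quad \Phi_2(t_0)=0.$$ Put $Y_i^{(1)}(t)=\Phi_1(t)[X_i(q(t))]$ and $Y_i^{(2)}(t,x)=\Phi_1(t)[D_{q(t)}X_i[\Phi_1(t)^{-1}x]]+\Phi_2(t)[X_i(q(t)),\Phi_1(t)^{-1}x]$.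 For a control $w$ let $q^{(1)}(t,w)$, $c^{(1)}(t,w)$, $q^{(2)}(t,w)$ vanish at $t_0$ and satisfy $$\dot q^{(1)}=\sum_i w_iY_i^{(1)}(t),\qquad \dot c^{(1)}=\sum_i w_iu_i(t),\qquad \dot q^{(2)}=\sum_i w_iY_i^{(2)}(t,q^{(1)}),$$ and let $R(t_0,t)=\{(q^{(1)},c^{(1)})(t,w): w\in L^\infty([t_0,t],\mathbb R^k)\}\subseteq\mathbb R^n\times\mathbb R$. The trajectory $q$ is *strictly abnormal* if $R(t_0,t_1)\subseteq V\times\mathbb R$ for some proper subspace $V\subset\mathbb R^n$, and $\{0\}\times\mathbb R\subseteq R(t_0,t_1)$. Fix $\psi_0\in(\mathbb R^n)^*$ and $t\in[t_0,t_1]$. The *characteristic optimal control problem* (OCP) on $[t_0,t]$ is to minimize $Q_t[w]=\langle q^{(2)}(t,w),\psi_0\rangle$ over the $w\in L^\infty([t_0,t],\mathbb R^k)$ with $(q^{(1)},c^{(1)})(t,w)=v$ prescribed; $Q_{\min}(t,v)\in[-\infty,+\infty]$ is its infimum, and $w$ is a *solution* if it is a minimizer for $v=(q^{(1)},c^{(1)})(t,w)$.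 A control $w\in L^\infty([t_0,t],\mathbb R^k)$ is a *normal extremal* of the OCP if there is an absolutely continuous covector curve $(\psi(s),a(s))\in(\mathbb R^n\times\mathbb R)^*$, $s\in[t_0,t]$, such that with $$H(s,(x,c),(\psi,a),z)=\Big\langle\sum_i z_iY_i^{(1)}(s),\psi\Big\rangle+a\sum_i z_iu_i(s)-\Big\langle\sum_i z_iY_i^{(2)}(s,x),\psi_0\Big\rangle$$ one has, for almost every $s\in[t_0,t]$, along $(x,c)=(q^{(1)},c^{(1)})(s,w)$: $(\dot\psi,\dot a)=-\partial H/\partial(x,c)$ at $z=w(s)$, and $H(s,(x,c),(\psi(s),a(s)),w(s))=\max_{z\in\mathbb R^k}H(s,(x,c),(\psi(s),a(s)),z)$. **Lemma.** Assume that $q$ is strictly abnormal. (i) If $Q_{\min}(t,0)$ is finite, then a control $w\in L^\infty([t_0,t],\mathbb R^k)$ is a solution of the characteristic OCP on $[t_0,t]$ if and only if it is a normal extremal of it. (ii) Suppose that there are symmetric bilinear maps $\Psi_2(s):\mathbb R^n\times\mathbb R^n\to\mathbb R$, linear maps $\zeta(s):\mathbb R^n\to\mathbb R$ and numbers $a_2(s)$,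 $s\in[t_0,t_1]$, such that, writing $\mathbf\Psi_2(s)(x,c)=\Psi_2(s)[x,x]+\langle x,\zeta(s)\rangle c+a_2(s)c^2$: - $Q_{\min}(s,v)=\mathbf\Psi_2(s)(v)$ for all $s\in[t_0,t_1]$ and $v\in R(t_0,s)$; - $\langle q^{(2)}(s,w),\psi_0\rangle-\mathbf\Psi_2(s)\big((q^{(1)},c^{(1)})(s,w)\big)\ge0$ for all $s\in[t_0,t_1]$ and $w\in L^\infty([t_0,t_1],\mathbb R^k)$; - $\Psi_2,\zeta,a_2$ are differentiable at almost every $s\in[t_0,t_1]$, and for almost every $s$ one has $\dot\Psi_2(s)[x,x]+\langle x,\dot\zeta(s)\rangle c+\dot a_2(s)c^2\le0$ for all $(x,c)\in R(t_0,s)$; - for almost every $s\in[t_0,t_1]$, all $i$ and all $x$ with $(x,c)\in R(t_0,s)$ for some $c$: $\langle Y_i^{(2)}(s,x),\psi_0\rangle-2\Psi_2(s)[x,Y_i^{(1)}(s)]-\langle x,\zeta(s)\rangle u_i(s)=0$ and $\langle Y_i^{(1)}(s),\zeta(s)\rangle+2a_2(s)u_i(s)=0$. If $w\in L^\infty([t_0,t],\mathbb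 R^k)$ is a solution of the characteristic OCP on $[t_0,t]$ with $\langle q^{(1)}(t,w),\zeta(t)\rangle+2a_2(t)c^{(1)}(t,w)\ne0$, then $q$ is of class $C^2$ on $[t_0,t]$. -/

import Mathlib

open MeasureTheory Set
open scoped ContDiff

noncomputable section

namespace SubRiem

/-- The space `ℝⁿ`; it serves as the (local) configuration manifold `M`, as the space of values of
the adapted coordinates, and (with `k` in place of `n`) as the space of control values. -/
abbrev Pt (n : ℕ) := EuclideanSpace ℝ (Fin n)

/-- `w` is (a representative of) an element of `L^∞([a, b], ℝᵏ)`. -/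
def InLinf {k : ℕ} (a b : ℝ) (w : ℝ → Pt k) : Prop :=
  MemLp w ⊤ (volume.restrict (Icc a b))

/-- A sub-Riemannian structure on `M = ℝⁿ`, given by a global orthonormal frame `X₁, …, X_k` of
smooth pointwise linearly independent vector fields, together with a trajectory
`q : [t₀, t₁] → M` of `q' = ∑ uᵢ Xᵢ(q)` (in the sense of Caratheodory, i.e. in integral form)
for a control `u ∈ L^∞([t₀, t₁], ℝᵏ)`. -/
structure SRTrajectory (n k : ℕ) where
  X : Fin k → Pt n → Pt n
  X_smooth : ∀ i, ContDiff ℝ ∞ (X i)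
  X_indep : ∀ x, LinearIndependent ℝ (fun i => X i x)
  t₀ : ℝ
  t₁ : ℝ
  t₀_lt_t₁ : t₀ < t₁
  u : ℝ → Pt k
  u_mem : InLinf t₀ t₁ u
  q : ℝ → Pt n
  q_cont : ContinuousOn q (Icc t₀ t₁)
  q_ode : ∀ t ∈ Icc t₀ t₁, q t = q t₀ + ∫ s in t₀..t, ∑ i, u s i • X i (q s)

/-- The adapted coordinates along a trajectory: the solutions `Φ₁(t) : T_{q(t)}M → ℝⁿ` (linear) and
`Φ₂(t) : T_{q(t)}M × T_{q(t)}M → ℝⁿ` (symmetric bilinear) of the linear Caratheodory ODEs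
* `Φ₁'(t)[b] + ∑ uᵢ(t) Φ₁(t)[DXᵢ b] = 0`,
* `Φ₂'(t)[b,b] + ∑ uᵢ(t) {Φ₁(t)[D²Xᵢ[b,b]] + 2 Φ₂(t)[DXᵢ b, b]} = 0`, `Φ₂(t₀) = 0`,
written in integral form. The initial value `L₀` of `Φ₁` is the isomorphism `T_{q(t₀)}M ≅ ℝⁿ` whose
components are the chosen basis of the cotangent space at `q(t₀)`. -/
structure AdaptedFrame {n k : ℕ} (S : SRTrajectory n k) where
  L₀ : Pt n ≃L[ℝ] Pt n
  Φ₁ : ℝ → Pt n →L[ℝ] Pt n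
  Φ₂ : ℝ → Pt n →L[ℝ] Pt n →L[ℝ] Pt n
  Φ₁_cont : ContinuousOn Φ₁ (Icc S.t₀ S.t₁)
  Φ₂_cont : ContinuousOn Φ₂ (Icc S.t₀ S.t₁)
  Φ₁_ode : ∀ t ∈ Icc S.t₀ S.t₁, ∀ b,
    Φ₁ t b = L₀ b - ∫ s in S.t₀..t, ∑ i, S.u s i • Φ₁ s (fderiv ℝ (S.X i) (S.q s) b)
  Φ₂_symm : ∀ t ∈ Icc S.t₀ S.t₁, ∀ b b', Φ₂ t b b' = Φ₂ t b' b
  Φ₂_ode : ∀ t ∈ Icc S.t₀ S.t₁, ∀ b,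
    Φ₂ t b b = - ∫ s in S.t₀..t, ∑ i, S.u s i •
      (Φ₁ s (fderiv ℝ (fderiv ℝ (S.X i)) (S.q s) b b)
        + (2 : ℝ) • Φ₂ s (fderiv ℝ (S.X i) (S.q s) b) b)

namespace AdaptedFrame

variable {n k : ℕ} {S : SRTrajectory n k} (F : AdaptedFrame S)

/-- `Yᵢ⁽¹⁾(t) = Φ₁(t)[Xᵢ(q(t))]`. -/
def Y1 (i : Fin k) (t : ℝ) : Pt n := F.Φ₁ t (S.X i (S.q t))

/-- `Yᵢ⁽²⁾(t, x) = Φ₁(t)[DXᵢ[A(t) x]] + Φ₂(t)[Xᵢ, A(t) x]`, with `A(t)` the inverse of `Φ₁(t)`. -/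
def Y2 (i : Fin k) (t : ℝ) (x : Pt n) : Pt n :=
  F.Φ₁ t (fderiv ℝ (S.X i) (S.q t) ((F.Φ₁ t).inverse x))
    + F.Φ₂ t (S.X i (S.q t)) ((F.Φ₁ t).inverse x)

/-- `q⁽¹⁾(t, w)`: the solution of `x' = ∑ wᵢ Yᵢ⁽¹⁾(t)`, `x(t₀) = 0`. -/
def q1 (t : ℝ) (w : ℝ → Pt k) : Pt n := ∫ s in S.t₀..t, ∑ i, w s i • F.Y1 i s

/-- `c⁽¹⁾(t, w)`: the solution of `c' = ∑ wᵢ uᵢ(t)`, `c(t₀) = 0`. -/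
def c1 (_F : AdaptedFrame S) (t : ℝ) (w : ℝ → Pt k) : ℝ :=
  ∫ s in S.t₀..t, ∑ i, w s i * S.u s i

/-- The trajectory `(q⁽¹⁾, c⁽¹⁾)(t, w)` of the characteristic control system started at zero. -/
def qq1 (t : ℝ) (w : ℝ → Pt k) : Pt n × ℝ := (F.q1 t w, F.c1 t w)

/-- `q⁽²⁾(t, w)`: the solution of `y' = ∑ wᵢ Yᵢ⁽²⁾(t, q⁽¹⁾(t, w))`, `y(t₀) = 0`. -/
def q2 (t : ℝ) (w : ℝ → Pt k) : Pt n := ∫ s in S.t₀..t, ∑ i, w s i • F.Y2 i s (F.q1 s w)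

/-- The reachable set `R(t₀, t) ⊆ ℝⁿ × ℝ` of the characteristic control system. -/
def reach (t : ℝ) : Set (Pt n × ℝ) := {v | ∃ w, InLinf S.t₀ t w ∧ F.qq1 t w = v}

/-- The trajectory is an extremal: `R(t₀, t₁)` is a proper subspace of `ℝⁿ × ℝ`. -/
def IsExtremal : Prop := F.reach S.t₁ ≠ univ

/-- Normal extremal: an extremal such that `R(t₀, t₁)` does not contain `{0} × ℝ`. -/
def IsNormalSR : Prop := F.IsExtremal ∧ ¬ (∀ c : ℝ, ((0 : Pt n), c) ∈ F.reach S.t₁)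

/-- Abnormal extremal: `R(t₀, t₁) ⊆ V × ℝ` for some proper subspace `V` of `ℝⁿ`. -/
def IsAbnormalSR : Prop :=
  ∃ V : Submodule ℝ (Pt n), V ≠ ⊤ ∧ ∀ v ∈ F.reach S.t₁, v.1 ∈ V

/-- Strictly abnormal extremal: abnormal and not normal. -/
def IsStrictlyAbnormal : Prop := F.IsAbnormalSR ∧ ¬ F.IsNormalSR

/-- The cost `⟨q⁽²⁾(t, w), ψ₀⟩` of the characteristic optimal control problem. -/
def cost (ψ₀ : Pt n →L[ℝ] ℝ) (t : ℝ) (w : ℝ → Pt k) : ℝ := ψ₀ (F.q2 t w)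

/-- The minimal 2-jet `Q_min(t, v)`, an extended real: the infimum of the cost over the controls in
`L^∞([t₀, t], ℝᵏ)` which steer the characteristic control system from `0` to `v` on `[t₀, t]`. -/
def Qmin (ψ₀ : Pt n →L[ℝ] ℝ) (t : ℝ) (v : Pt n × ℝ) : EReal :=
  sInf ((fun w => (F.cost ψ₀ t w : EReal)) '' {w | InLinf S.t₀ t w ∧ F.qq1 t w = v})

/-- `w` solves the characteristic optimal control problem on `[t₀, t]` (for its own end-point
`v = (q⁽¹⁾, c⁽¹⁾)(t, w)`). -/
def IsSolution (ψ₀ : Pt n →L[ℝ] ℝ) (t : ℝ) (w : ℝ → Pt k) : Prop :=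
  InLinf S.t₀ t w ∧
    ∀ w', InLinf S.t₀ t w' → F.qq1 t w' = F.qq1 t w → F.cost ψ₀ t w ≤ F.cost ψ₀ t w'

/-- The Pontryagin Hamiltonian of the characteristic optimal control problem, at time `s`, state
`x ∈ ℝⁿ × ℝ`, covector `(ψ, a)`, control value `w`, with cost multiplier `p₀`. -/
def hamiltonian (ψ₀ : Pt n →L[ℝ] ℝ) (p₀ s : ℝ) (x : Pt n × ℝ) (ψ : Pt n →L[ℝ] ℝ) (a : ℝ)
    (w : Pt k) : ℝ :=
  ψ (∑ i, w i • F.Y1 i s) + a * ∑ i, w i * S.u s i + p₀ * ψ₀ (∑ i, w i • F.Y2 i s x.1)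

/-- The control `w ∈ L^∞([t₀, t], ℝᵏ)` with the covector curve `(ψ, a)` and the multiplier `p₀`
satisfies the Pontryagin Maximum Principle for the characteristic optimal control problem:
the adjoint equation `(ψ, a)' = - ∂H/∂(q⁽¹⁾, c⁽¹⁾)` (in integral form), the maximum condition, and
non-triviality. -/
structure IsPontryagin (ψ₀ : Pt n →L[ℝ] ℝ) (p₀ t : ℝ) (w : ℝ → Pt k)
    (ψ : ℝ → Pt n →L[ℝ] ℝ) (a : ℝ → ℝ) : Prop where
  mem : InLinf S.t₀ t w
  adjoint : ∀ s ∈ Icc S.t₀ t, ∀ v : Pt n × ℝ,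
    ψ s v.1 + a s * v.2 = ψ S.t₀ v.1 + a S.t₀ * v.2 -
      ∫ σ in S.t₀..s,
        fderiv ℝ (fun x => F.hamiltonian ψ₀ p₀ σ x (ψ σ) (a σ) (w σ)) (F.qq1 σ w) v
  maximum : ∀ᵐ s ∂(volume.restrict (Icc S.t₀ t)), ∀ z : Pt k,
    F.hamiltonian ψ₀ p₀ s (F.qq1 s w) (ψ s) (a s) z
      ≤ F.hamiltonian ψ₀ p₀ s (F.qq1 s w) (ψ s) (a s) (w s)
  nontrivial : ∀ s ∈ Icc S.t₀ t, ¬ (ψ s = 0 ∧ a s = 0 ∧ p₀ = 0)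

/-- Normal extremal of the characteristic optimal control problem on `[t₀, t]`: `p₀ = -1`. -/
def IsNormalExtremal (ψ₀ : Pt n →L[ℝ] ℝ) (t : ℝ) (w : ℝ → Pt k) : Prop :=
  ∃ (ψ : ℝ → Pt n →L[ℝ] ℝ) (a : ℝ → ℝ), F.IsPontryagin ψ₀ (-1) t w ψ a

/-- The quadratic form `(x, c) ↦ Ψ[x, x] + ⟨x, ζ⟩ c + a c²` on `ℝⁿ × ℝ`. -/
def quad (Ψ : Pt n →L[ℝ] Pt n →L[ℝ] ℝ) (ζ : Pt n →L[ℝ] ℝ) (a : ℝ) (v : Pt n × ℝ) : ℝ :=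
  Ψ v.1 v.1 + ζ v.1 * v.2 + a * v.2 ^ 2

/-- The families `Ψ₂(t)`, `ζ(t)`, `a₂(t)`, `t ∈ [t₀, t₁]`, represent the minimal 2-jet and satisfy
the second-order optimality conditions in adapted coordinates. -/
structure SecondOrderConditions (ψ₀ : Pt n →L[ℝ] ℝ) (Ψ₂ : ℝ → Pt n →L[ℝ] Pt n →L[ℝ] ℝ)
    (ζ : ℝ → Pt n →L[ℝ] ℝ) (a₂ : ℝ → ℝ) : Prop where
  symm : ∀ t ∈ Icc S.t₀ S.t₁, ∀ x y, Ψ₂ t x y = Ψ₂ t y x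
  /-- In particular the minimal 2-jet is finite on the reachable set. -/
  value : ∀ t ∈ Icc S.t₀ S.t₁, ∀ v ∈ F.reach t,
    F.Qmin ψ₀ t v = ((quad (Ψ₂ t) (ζ t) (a₂ t) v : ℝ) : EReal)
  nonneg : ∀ t ∈ Icc S.t₀ S.t₁, ∀ w, InLinf S.t₀ S.t₁ w →
    0 ≤ ψ₀ (F.q2 t w) - quad (Ψ₂ t) (ζ t) (a₂ t) (F.qq1 t w)
  differentiable : ∀ᵐ t ∂(volume.restrict (Icc S.t₀ S.t₁)),
    DifferentiableAt ℝ Ψ₂ t ∧ DifferentiableAt ℝ ζ t ∧ DifferentiableAt ℝ a₂ t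
  /-- The form is non-increasing in time, as the minimal 2-jet is. -/
  deriv_nonpos : ∀ᵐ t ∂(volume.restrict (Icc S.t₀ S.t₁)), ∀ v ∈ F.reach t,
    quad (deriv Ψ₂ t) (deriv ζ t) (deriv a₂ t) v ≤ 0
  eq_first : ∀ᵐ t ∂(volume.restrict (Icc S.t₀ S.t₁)), ∀ i, ∀ v ∈ F.reach t,
    ψ₀ (F.Y2 i t v.1) - 2 * Ψ₂ t v.1 (F.Y1 i t) - ζ t v.1 * S.u t i = 0
  eq_second : ∀ᵐ t ∂(volume.restrict (Icc S.t₀ S.t₁)), ∀ i,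
    ζ t (F.Y1 i t) + 2 * a₂ t * S.u t i = 0

end AdaptedFrame

end SubRiem

end

/-! The end-point map `w ↦ (q⁽¹⁾, c⁽¹⁾)(t, w)` is linear and the cost is a quadratic form in `w`,
since `Y⁽²⁾` is linear in `x`. Everything follows from its first variation `costPolar`.

(i) Controls with a common end-point differ by elements of the kernel of the end-point map.
Finiteness of `Q_min(t, 0)` makes the cost nonnegative on this kernel, as a negative value would
scale to `-∞`. Hence `w` is a solution exactly when its first variation vanishes on the kernel, i.e.
factors through the end-point map. Integration by parts turns the factoring functional (a Lagrange
multiplier) into a solution `(ψ, a)` of the adjoint equation with `a` constant. Since the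
Hamiltonian is linear in the control, the maximum condition says that its coefficients vanish:
`⟨Yᵢ⁽²⁾(s, q⁽¹⁾), ψ₀⟩ - ψ(s)[Yᵢ⁽¹⁾(s)] = a uᵢ(s)`.

(ii) The difference between the cost and `𝚿₂` at the end-point is nonnegative and vanishes at a
solution, so the multiplier is the differential of `𝚿₂`; in particular `a = m := ⟨q⁽¹⁾, ζ⟩ + 2 a₂
c⁽¹⁾` at time `t`. As `m ≠ 0`, the stationarity condition gives `u = f / m` almost everywhere, with
`f` its Lipschitz left side. In `f'` the terms containing the merely bounded `w` are `∑ⱼ wⱼ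
(⟨Yᵢ⁽²⁾(s, Yⱼ⁽¹⁾), ψ₀⟩ - ⟨Yⱼ⁽²⁾(s, Yᵢ⁽¹⁾), ψ₀⟩)`, which vanish by the Goh condition
`SecondOrderConditions.goh`. What remains is linear in `u = f / m` with continuous coefficients, so
`f` is `C¹`, and `q` is `C²`. -/

noncomputable section

namespace SubRiem

/-! ### Lipschitz curves, their almost everywhere derivatives, and a Grönwall lemma -/

section Calculus

variable {E F : Type*} [NormedAddCommGroup E] [NormedSpace ℝ E]
  [NormedAddCommGroup F] [NormedSpace ℝ F] {a b : ℝ}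

/-- `f` is Lipschitz on `[a, b]` with almost everywhere derivative `f'`. -/
def LipDeriv (a b : ℝ) (f f' : ℝ → E) : Prop :=
  (∃ K, LipschitzOnWith K f (Icc a b)) ∧
    ∀ᵐ s ∂(volume.restrict (Icc a b)), HasDerivAt f (f' s) s

theorem LipDeriv.continuousOn {f f' : ℝ → E} (h : LipDeriv a b f f') :
    ContinuousOn f (Icc a b) := by
  obtain ⟨⟨K, hK⟩, -⟩ := h
  exact hK.continuousOn

theorem LipDeriv.mono {f f' : ℝ → E} (h : LipDeriv a b f f') {c d : ℝ}
    (hcd : Icc c d ⊆ Icc a b) : LipDeriv c d f f' := by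
  obtain ⟨⟨K, hK⟩, h2⟩ := h
  exact ⟨⟨K, hK.mono hcd⟩, ae_restrict_of_ae_restrict_of_subset hcd h2⟩

theorem LipDeriv.congr_deriv {f f' g' : ℝ → E} (h : LipDeriv a b f f')
    (hg : f' =ᵐ[volume.restrict (Icc a b)] g') : LipDeriv a b f g' := by
  refine ⟨h.1, ?_⟩
  filter_upwards [h.2, hg] with s hs hs'
  rwa [← hs']

/-- A `C¹` map is Lipschitz near each point of the curve; compactness of the interval makes the
constant uniform. -/
theorem lipschitzOn_comp_contDiffAt {f : ℝ → E} {φ : E → F}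
    (h : ∃ K, LipschitzOnWith K f (Icc a b)) (hφ : ∀ s ∈ Icc a b, ContDiffAt ℝ 1 φ (f s)) :
    ∃ K, LipschitzOnWith K (fun s => φ (f s)) (Icc a b) := by
  obtain ⟨K, hK⟩ := h
  apply LocallyLipschitzOn.exists_lipschitzOnWith_of_compact isCompact_Icc
  intro s hs
  obtain ⟨K', t, ht, hK'⟩ := (hφ s hs).exists_lipschitzOnWith
  refine ⟨K' * K, f ⁻¹' t ∩ Icc a b, ?_, ?_⟩
  · exact Filter.inter_mem (hK.continuousOn s hs ht) self_mem_nhdsWithin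
  · exact hK'.comp (hK.mono inter_subset_right) (fun x hx => hx.1)

theorem LipDeriv.comp {f f' : ℝ → E} {φ : E → F} (h : LipDeriv a b f f')
    (hφ : ∀ s ∈ Icc a b, ContDiffAt ℝ 1 φ (f s)) :
    LipDeriv a b (fun s => φ (f s)) (fun s => fderiv ℝ φ (f s) (f' s)) := by
  refine ⟨lipschitzOn_comp_contDiffAt h.1 hφ, ?_⟩
  filter_upwards [h.2, ae_restrict_mem measurableSet_Icc] with s hs hs'
  exact ((hφ s hs').differentiableAt one_ne_zero).hasFDerivAt.comp_hasDerivAt s hs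

theorem LipDeriv.prodMk {f f' : ℝ → E} {g g' : ℝ → F} (hf : LipDeriv a b f f')
    (hg : LipDeriv a b g g') :
    LipDeriv a b (fun s => (f s, g s)) (fun s => (f' s, g' s)) := by
  obtain ⟨⟨K, hK⟩, h2⟩ := hf
  obtain ⟨⟨K', hK'⟩, h2'⟩ := hg
  refine ⟨⟨_, hK.prodMk hK'⟩, ?_⟩
  filter_upwards [h2, h2'] with s hs hs'
  exact hs.prodMk hs'

theorem LipDeriv.clm_apply {f f' : ℝ → E →L[ℝ] F} {g g' : ℝ → E} (hf : LipDeriv a b f f')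
    (hg : LipDeriv a b g g') :
    LipDeriv a b (fun s => f s (g s)) (fun s => f' s (g s) + f s (g' s)) := by
  refine ⟨lipschitzOn_comp_contDiffAt (φ := fun p : (E →L[ℝ] F) × E => p.1 p.2)
    (hf.prodMk hg).1 (fun s _ => isBoundedBilinearMap_apply.contDiff.contDiffAt), ?_⟩
  filter_upwards [hf.2, hg.2] with s hs hs'
  exact hs.clm_apply hs'

theorem LipDeriv.sub {f f' g g' : ℝ → E} (hf : LipDeriv a b f f') (hg : LipDeriv a b g g') :
    LipDeriv a b (fun s => f s - g s) (fun s => f' s - g' s) := by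
  refine ⟨lipschitzOn_comp_contDiffAt (φ := fun p : E × E => p.1 - p.2)
    (hf.prodMk hg).1 (fun s _ => (contDiff_fst.sub contDiff_snd).contDiffAt), ?_⟩
  filter_upwards [hf.2, hg.2] with s hs hs'
  exact hs.sub hs'

omit [NormedSpace ℝ E] in
theorem intervalIntegrable_of_memLp_top {f : ℝ → E}
    (hf : MemLp f ⊤ (volume.restrict (Icc a b))) {c d : ℝ} (hc : c ∈ Icc a b) (hd : d ∈ Icc a b) :
    IntervalIntegrable f volume c d := by
  have h1 : IntegrableOn f (Icc a b) := hf.integrable le_top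
  exact (h1.mono_set (uIcc_subset_Icc hc hd)).intervalIntegrable

omit [NormedSpace ℝ E] in
theorem exists_ae_norm_le_of_memLp_top {f : ℝ → E} {μ : Measure ℝ} (hf : MemLp f ⊤ μ) :
    ∃ C : ℝ, ∀ᵐ s ∂μ, ‖f s‖ ≤ C := by
  refine ⟨(eLpNormEssSup f μ).toReal, ?_⟩
  have hfin : eLpNormEssSup f μ < ⊤ := by simpa using hf.2
  filter_upwards [enorm_ae_le_eLpNormEssSup f μ] with s hs
  rw [← toReal_enorm]
  exact ENNReal.toReal_mono hfin.ne hs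

theorem LipDeriv.of_integral [CompleteSpace E] {f f' : ℝ → E}
    (hf' : MemLp f' ⊤ (volume.restrict (Icc a b)))
    (h : ∀ s ∈ Icc a b, f s = f a + ∫ σ in a..s, f' σ) : LipDeriv a b f f' := by
  rcases lt_or_ge b a with hba | hab
  · simp [LipDeriv, Icc_eq_empty_of_lt hba]
  have ha : a ∈ Icc a b := ⟨le_rfl, hab⟩
  have hb : b ∈ Icc a b := ⟨hab, le_rfl⟩
  constructor
  · obtain ⟨C, hC⟩ := exists_ae_norm_le_of_memLp_top hf'
    refine ⟨C.toNNReal, LipschitzOnWith.of_dist_le_mul fun x hx y hy => ?_⟩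
    have hsub : f x - f y = ∫ σ in y..x, f' σ := by
      rw [h x hx, h y hy, add_sub_add_left_eq_sub, intervalIntegral.integral_interval_sub_left
        (intervalIntegrable_of_memLp_top hf' ha hx) (intervalIntegrable_of_memLp_top hf' ha hy)]
    rw [dist_eq_norm, hsub, Real.dist_eq]
    refine (intervalIntegral.norm_integral_le_of_norm_le_const_ae ?_).trans
      (mul_le_mul_of_nonneg_right (Real.le_coe_toNNReal C) (abs_nonneg _))
    rw [ae_restrict_iff' measurableSet_Icc] at hC
    filter_upwards [hC] with s hs hs'
    exact hs (uIcc_subset_Icc hy hx (uIoc_subset_uIcc hs'))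
  · have hd := (intervalIntegrable_of_memLp_top hf' ha hb).ae_hasDerivAt_integral
    -- The derivative is two-sided while `h` is known only on `[a, b]`, so the two end-points are
    -- discarded as a null set.
    rw [← restrict_Ioo_eq_restrict_Icc, ae_restrict_iff' measurableSet_Ioo]
    filter_upwards [hd] with s hs hs'
    have hsI : s ∈ uIcc a b := by rw [uIcc_of_le hab]; exact Ioo_subset_Icc_self hs'
    have h1 := (hs hsI a left_mem_uIcc).const_add (f a)
    refine h1.congr_of_eventuallyEq ?_
    filter_upwards [Ioo_mem_nhds hs'.1 hs'.2] with x hx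
    exact h x (Ioo_subset_Icc_self hx)

theorem LipDeriv.integral_eq {f f' : ℝ → ℝ} (h : LipDeriv a b f f') {s : ℝ} (hs : s ∈ Icc a b) :
    ∫ σ in a..s, f' σ = f s - f a := by
  obtain ⟨⟨K, hK⟩, h2⟩ := h
  have hsub : uIcc a s ⊆ Icc a b := uIcc_subset_Icc ⟨le_rfl, hs.1.trans hs.2⟩ hs
  rw [← ((hK.mono hsub).absolutelyContinuousOnInterval).integral_deriv_eq_sub]
  apply intervalIntegral.integral_congr_ae
  rw [ae_restrict_iff' measurableSet_Icc] at h2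
  filter_upwards [h2] with x hx hx'
  exact ((hx (hsub (uIoc_subset_uIcc hx'))).deriv).symm

theorem memLp_top_smul {f : ℝ → ℝ} {g : ℝ → E} {μ : Measure ℝ}
    (hf : MemLp f ⊤ μ) (hg : MemLp g ⊤ μ) : MemLp (fun s => f s • g s) ⊤ μ :=
  hg.smul (p := ⊤) (q := ⊤) (r := ⊤) hf

omit [NormedSpace ℝ E] in
theorem memLp_top_of_continuousOn {f : ℝ → E} (hf : ContinuousOn f (Icc a b)) :
    MemLp f ⊤ (volume.restrict (Icc a b)) := by
  obtain ⟨C, hC⟩ := isCompact_Icc.exists_bound_of_continuousOn hf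
  refine memLp_top_of_bound (hf.aestronglyMeasurable measurableSet_Icc) C ?_
  filter_upwards [ae_restrict_mem measurableSet_Icc] with s hs using hC s hs

omit [NormedSpace ℝ E] in
/-- A Carathéodory version of Grönwall's lemma backwards in time: a solution of a linear
differential inequality which vanishes at the end-point is zero. -/
theorem eq_zero_of_norm_le_integral {f : ℝ → E} (hf : ContinuousOn f (Icc a b)) {C : ℝ}
    (h : ∀ s ∈ Icc a b, ‖f s‖ ≤ C * ∫ σ in s..b, ‖f σ‖) : ∀ s ∈ Icc a b, f s = 0 := by
  rcases lt_or_ge b a with hba | hab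
  · simp [Icc_eq_empty_of_lt hba]
  have hb : b ∈ Icc a b := ⟨hab, le_rfl⟩
  have hint : ∀ s ∈ Icc a b, IntervalIntegrable (fun σ => ‖f σ‖) volume s b := fun s hs =>
    (hf.norm.mono (uIcc_subset_Icc hs hb)).intervalIntegrable
  -- Integrating factor: `G' = e^{Cs} (C ∫_s^b ‖f‖ - ‖f‖) ≥ 0`, so `0 ≤ G ≤ G b = 0`.
  set G : ℝ → ℝ := fun s => (∫ σ in s..b, ‖f σ‖) * Real.exp (C * s) with hG
  have hcont : ContinuousOn (fun s => ∫ σ in s..b, ‖f σ‖) (Icc a b) := by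
    have h1 : ContinuousOn (fun s => ∫ σ in b..s, ‖f σ‖) (uIcc a b) :=
      intervalIntegral.continuousOn_primitive_interval' (hint a ⟨le_rfl, hab⟩) right_mem_uIcc
    rw [uIcc_of_le hab] at h1
    exact h1.neg.congr fun s _ => intervalIntegral.integral_symm _ _
  have hmono : MonotoneOn G (Icc a b) := by
    apply monotoneOn_of_hasDerivWithinAt_nonneg (convex_Icc a b)
      (f' := fun s => -‖f s‖ * Real.exp (C * s) +
        (∫ σ in s..b, ‖f σ‖) * (Real.exp (C * s) * (C * 1)))
    · exact hcont.mul (by fun_prop)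
    · intro s hs
      rw [interior_Icc] at hs
      have hs' := Ioo_subset_Icc_self hs
      have hnhds : Icc a b ∈ nhds s := Icc_mem_nhds hs.1 hs.2
      have h1 : HasDerivAt (fun s => ∫ σ in s..b, ‖f σ‖) (-‖f s‖) s :=
        intervalIntegral.integral_hasDerivAt_left (hint s hs')
          ⟨Icc a b, hnhds, hf.norm.aestronglyMeasurable measurableSet_Icc⟩
          (hf.norm.continuousAt hnhds)
      exact (h1.mul (((hasDerivAt_id s).const_mul C).exp)).hasDerivWithinAt
    · intro s hs
      rw [interior_Icc] at hs
      have := h s (Ioo_subset_Icc_self hs)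
      have he := Real.exp_pos (C * s)
      nlinarith
  intro s hs
  have h1 : G s ≤ G b := hmono hs hb hs.2
  have h2 : G b = 0 := by simp [hG]
  have h3 : 0 ≤ ∫ σ in s..b, ‖f σ‖ :=
    intervalIntegral.integral_nonneg hs.2 fun _ _ => norm_nonneg _
  have h4 : ∫ σ in s..b, ‖f σ‖ = 0 := by
    have he := Real.exp_pos (C * s)
    rw [h2] at h1
    exact le_antisymm (nonpos_of_mul_nonpos_left h1 he) h3
  have := h s hs
  rw [h4, mul_zero] at this
  exact norm_le_zero_iff.1 this

end Calculus

/-! ### Curves whose derivative is linear in the control, with continuous coefficients -/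

section Driven

variable {E F : Type*} [NormedAddCommGroup E] [NormedSpace ℝ E]
  [NormedAddCommGroup F] [NormedSpace ℝ F] {a b : ℝ} {k : ℕ} {u : ℝ → Pt k}

theorem InLinf.coord {w : ℝ → Pt k} (hw : InLinf a b w) (i : Fin k) :
    MemLp (fun s => w s i) ⊤ (volume.restrict (Icc a b)) :=
  (EuclideanSpace.proj (𝕜 := ℝ) i : Pt k →L[ℝ] ℝ).comp_memLp' hw

theorem InLinf.mono {w : ℝ → Pt k} (hw : InLinf a b w) {c d : ℝ}
    (h : Icc c d ⊆ Icc a b) : InLinf c d w :=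
  MemLp.mono_measure (Measure.restrict_mono h le_rfl) hw

theorem InLinf.memLp_sum_smul {w : ℝ → Pt k} (hw : InLinf a b w) {G : Fin k → ℝ → E}
    (hG : ∀ j, ContinuousOn (G j) (Icc a b)) :
    MemLp (fun s => ∑ j, w s j • G j s) ⊤ (volume.restrict (Icc a b)) :=
  memLp_finsetSum _ fun j _ => memLp_top_smul (hw.coord j) (memLp_top_of_continuousOn (hG j))

/-- `f` is Lipschitz and its derivative is a linear combination with continuous coefficients of the
components of `u`. -/
def DrivenBy (a b : ℝ) (u : ℝ → Pt k) (f : ℝ → E) : Prop :=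
  ∃ G : Fin k → ℝ → E, (∀ j, ContinuousOn (G j) (Icc a b)) ∧
    LipDeriv a b f (fun s => ∑ j, u s j • G j s)

theorem DrivenBy.continuousOn {f : ℝ → E} (h : DrivenBy a b u f) : ContinuousOn f (Icc a b) := by
  obtain ⟨G, -, h⟩ := h
  exact h.continuousOn

theorem DrivenBy.mono {f : ℝ → E} (h : DrivenBy a b u f) {c d : ℝ}
    (hcd : Icc c d ⊆ Icc a b) : DrivenBy c d u f := by
  obtain ⟨G, hG, h⟩ := h
  exact ⟨G, fun j => (hG j).mono hcd, h.mono hcd⟩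

theorem DrivenBy.of_integral [CompleteSpace E] (hu : InLinf a b u) {f : ℝ → E}
    {G : Fin k → ℝ → E} (hG : ∀ j, ContinuousOn (G j) (Icc a b))
    (h : ∀ s ∈ Icc a b, f s = f a + ∫ σ in a..s, ∑ j, u σ j • G j σ) : DrivenBy a b u f :=
  ⟨G, hG, LipDeriv.of_integral (hu.memLp_sum_smul hG) h⟩

theorem DrivenBy.prodMk {f : ℝ → E} {g : ℝ → F} (hf : DrivenBy a b u f) (hg : DrivenBy a b u g) :
    DrivenBy a b u (fun s => (f s, g s)) := by
  obtain ⟨G, hG, hf⟩ := hf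
  obtain ⟨G', hG', hg⟩ := hg
  refine ⟨fun j s => (G j s, G' j s), fun j => (hG j).prodMk (hG' j), ?_⟩
  refine (hf.prodMk hg).congr_deriv (Filter.Eventually.of_forall fun s => ?_)
  simp [Prod.ext_iff, Prod.fst_sum, Prod.snd_sum]

/-- The chain rule keeps the derivative linear in `u`. Together with pairing, it yields the closure
under sums, evaluation, composition and inversion of operators. -/
theorem DrivenBy.comp {f : ℝ → E} {φ : E → F} (h : DrivenBy a b u f)
    (hφ : ∀ s ∈ Icc a b, ContDiffAt ℝ 1 φ (f s)) : DrivenBy a b u (fun s => φ (f s)) := by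
  have hc := h.continuousOn
  obtain ⟨G, hG, h⟩ := h
  refine ⟨fun j s => fderiv ℝ φ (f s) (G j s), fun j => ?_, ?_⟩
  · refine ContinuousOn.clm_apply (fun s hs => ?_) (hG j)
    have h1 : ContinuousAt (fderiv ℝ φ) (f s) :=
      ((hφ s hs).fderiv_right (m := 0) (by simp)).continuousAt
    exact h1.comp_continuousWithinAt (hc s hs)
  · refine (h.comp hφ).congr_deriv (Filter.Eventually.of_forall fun s => ?_)
    simp

theorem DrivenBy.comp_contDiff {f : ℝ → E} {φ : E → F} (h : DrivenBy a b u f)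
    (hφ : ContDiff ℝ 1 φ) : DrivenBy a b u (fun s => φ (f s)) :=
  h.comp fun _ _ => hφ.contDiffAt

theorem DrivenBy.clm_apply {f : ℝ → E →L[ℝ] F} {g : ℝ → E} (hf : DrivenBy a b u f)
    (hg : DrivenBy a b u g) : DrivenBy a b u (fun s => f s (g s)) :=
  (hf.prodMk hg).comp_contDiff (φ := fun p : (E →L[ℝ] F) × E => p.1 p.2)
    isBoundedBilinearMap_apply.contDiff

theorem DrivenBy.add {f g : ℝ → E} (hf : DrivenBy a b u f)
    (hg : DrivenBy a b u g) : DrivenBy a b u (fun s => f s + g s) :=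
  (hf.prodMk hg).comp_contDiff (φ := fun p : E × E => p.1 + p.2)
    (contDiff_fst.add contDiff_snd)

theorem DrivenBy.clm_comp {D : Type*} [NormedAddCommGroup D] [NormedSpace ℝ D]
    {f : ℝ → E →L[ℝ] F} {g : ℝ → D →L[ℝ] E} (hf : DrivenBy a b u f)
    (hg : DrivenBy a b u g) : DrivenBy a b u (fun s => (f s).comp (g s)) :=
  (hf.prodMk hg).comp_contDiff (φ := fun p : (E →L[ℝ] F) × (D →L[ℝ] E) => p.1.comp p.2)
    (isBoundedBilinearMap_comp.contDiff)

end Driven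

/-! ### Recovering symmetric bilinear curves from their diagonals -/

section Bilinear

variable {V W : Type*} [NormedAddCommGroup V] [NormedSpace ℝ V]
  [NormedAddCommGroup W] [NormedSpace ℝ W] {a b : ℝ} {k : ℕ} {u : ℝ → Pt k}

/-- The symmetrization of `(v, v') ↦ A[E[v, v']] + 2 B[D v, v']`. -/
def symmCoeff (A : V →L[ℝ] W) (E : V →L[ℝ] V →L[ℝ] V) (B : V →L[ℝ] V →L[ℝ] W) (D : V →L[ℝ] V) :
    V →L[ℝ] V →L[ℝ] W :=
  (1 / 2 : ℝ) • ((ContinuousLinearMap.compL ℝ V V W A).comp E + (2 : ℝ) • B.comp D +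
    ((ContinuousLinearMap.compL ℝ V V W A).comp E + (2 : ℝ) • B.comp D).flip)

theorem symmCoeff_symm (A : V →L[ℝ] W) (E : V →L[ℝ] V →L[ℝ] V) (B : V →L[ℝ] V →L[ℝ] W)
    (D : V →L[ℝ] V) (v v' : V) : symmCoeff A E B D v v' = symmCoeff A E B D v' v := by
  simp only [symmCoeff, smul_apply, add_apply, ContinuousLinearMap.flip_apply]
  congr 1
  abel

theorem symmCoeff_diag (A : V →L[ℝ] W) (E : V →L[ℝ] V →L[ℝ] V) (B : V →L[ℝ] V →L[ℝ] W)
    (D : V →L[ℝ] V) (v : V) : symmCoeff A E B D v v = A (E v v) + (2 : ℝ) • B (D v) v := by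
  simp only [symmCoeff, smul_apply, add_apply, ContinuousLinearMap.flip_apply,
    ContinuousLinearMap.comp_apply, ContinuousLinearMap.compL_apply]
  rw [← two_smul ℝ, smul_smul]
  norm_num

theorem continuousOn_symmCoeff {s : Set ℝ} {A : ℝ → V →L[ℝ] W} {E : ℝ → V →L[ℝ] V →L[ℝ] V}
    {B : ℝ → V →L[ℝ] V →L[ℝ] W} {D : ℝ → V →L[ℝ] V} (hA : ContinuousOn A s)
    (hE : ContinuousOn E s) (hB : ContinuousOn B s) (hD : ContinuousOn D s) :
    ContinuousOn (fun σ => symmCoeff (A σ) (E σ) (B σ) (D σ)) s := by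
  have h1 : ContinuousOn (fun σ => (ContinuousLinearMap.compL ℝ V V W (A σ)).comp (E σ)) s :=
    ((ContinuousLinearMap.compL ℝ V V W).continuous.comp_continuousOn hA).clm_comp hE
  have h2 : ContinuousOn (fun σ => (B σ).comp (D σ)) s := hB.clm_comp hD
  have h3 : ContinuousOn (fun σ => (ContinuousLinearMap.compL ℝ V V W (A σ)).comp (E σ) +
      (2 : ℝ) • (B σ).comp (D σ)) s :=
    ContinuousOn.add (M := V →L[ℝ] V →L[ℝ] W) h1
      (ContinuousOn.const_smul (α := V →L[ℝ] V →L[ℝ] W) h2 (2 : ℝ))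
  have h4 := (ContinuousLinearMap.flipₗᵢ ℝ V V W).continuous.comp_continuousOn h3
  exact ContinuousOn.const_smul (α := V →L[ℝ] V →L[ℝ] W)
    (ContinuousOn.add (M := V →L[ℝ] V →L[ℝ] W) h3 h4) (1 / 2 : ℝ)

theorem clm_eq_of_symm_of_diag {Φ M : V →L[ℝ] V →L[ℝ] W} (hΦ : ∀ v v', Φ v v' = Φ v' v)
    (hM : ∀ v v', M v v' = M v' v) (h : ∀ v, Φ v v = M v v) : Φ = M := by
  ext v v'
  have h1 := h (v + v')
  simp only [map_add, add_apply, h v, h v', hΦ v' v, hM v' v] at h1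
  have h2 : (2 : ℝ) • Φ v v' = (2 : ℝ) • M v v' := by
    rw [two_smul, two_smul]
    have h3 : M v v + Φ v v' + (Φ v v' + M v' v') =
      M v v + M v' v' + (Φ v v' + Φ v v') := by abel
    have h4 : M v v + M v v' + (M v v' + M v' v') =
      M v v + M v' v' + (M v v' + M v v') := by abel
    rw [h3, h4] at h1
    exact add_left_cancel h1
  exact smul_right_injective _ (two_ne_zero' ℝ) h2

/-- A curve of symmetric bilinear maps whose diagonal is driven by `u` is driven by `u`. -/
theorem DrivenBy.of_symm_of_diag [CompleteSpace W] (hu : InLinf a b u) (hab : a ≤ b)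
    {Φ : ℝ → V →L[ℝ] V →L[ℝ] W} {M : Fin k → ℝ → V →L[ℝ] V →L[ℝ] W}
    (hΦ : ∀ t ∈ Icc a b, ∀ v v', Φ t v v' = Φ t v' v)
    (hMc : ∀ j, ContinuousOn (M j) (Icc a b)) (hM : ∀ j t v v', M j t v v' = M j t v' v)
    (h : ∀ t ∈ Icc a b, ∀ v, Φ t v v = -∫ s in a..t, ∑ j, u s j • M j s v v) :
    DrivenBy a b u Φ := by
  have ha : a ∈ Icc a b := ⟨le_rfl, hab⟩
  have hmem := hu.memLp_sum_smul (E := V →L[ℝ] V →L[ℝ] W) hMc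
  -- The equation is given on the diagonal only; both sides here are symmetric, so polarization
  -- extends it to all pairs.
  have key : ∀ t ∈ Icc a b, Φ t = -∫ s in a..t, ∑ j, u s j • M j s := by
    intro t ht
    have hint := intervalIntegrable_of_memLp_top hmem ha ht
    have happ : ∀ v v', (-∫ s in a..t, ∑ j, u s j • M j s) v v' =
        -∫ s in a..t, ∑ j, u s j • M j s v v' := fun v v' => by
      rw [neg_apply, neg_apply, ContinuousLinearMap.intervalIntegral_apply hint,
        ContinuousLinearMap.intervalIntegral_apply]
      · simp [sum_apply]
      · simp only [sum_apply, smul_apply]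
        exact intervalIntegrable_of_memLp_top
          (hu.memLp_sum_smul (E := V →L[ℝ] W) fun j => (hMc j).clm_apply continuousOn_const) ha ht
    refine clm_eq_of_symm_of_diag (hΦ t ht) (fun v v' => ?_) fun v => ?_
    · rw [happ, happ]
      simp only [hM _ _ v v']
    · rw [happ, h t ht]
  refine DrivenBy.of_integral hu (fun j => (hMc j).neg) fun s hs => ?_
  have h0 : Φ a = 0 := by simpa using key a ha
  rw [key s hs, h0, zero_add, ← intervalIntegral.integral_neg]
  simp

end Bilinear

/-! ### The trajectory, the adapted coordinates and the fields `Y⁽¹⁾`, `Y⁽²⁾` as driven curves -/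

namespace SRTrajectory

variable {n k : ℕ} (S : SRTrajectory n k)

theorem t₀_mem : S.t₀ ∈ Icc S.t₀ S.t₁ := ⟨le_rfl, S.t₀_lt_t₁.le⟩

theorem contDiff_fderiv_X (i : Fin k) : ContDiff ℝ ∞ (fderiv ℝ (S.X i)) :=
  (S.X_smooth i).fderiv_right (by simp)

theorem contDiff_fderiv_fderiv_X (i : Fin k) : ContDiff ℝ ∞ (fderiv ℝ (fderiv ℝ (S.X i))) :=
  (S.contDiff_fderiv_X i).fderiv_right (by simp)

theorem continuousOn_comp_q {E : Type*} [NormedAddCommGroup E] [NormedSpace ℝ E]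
    {φ : Pt n → E} (hφ : ContDiff ℝ ∞ φ) :
    ContinuousOn (fun s => φ (S.q s)) (Icc S.t₀ S.t₁) :=
  hφ.continuous.comp_continuousOn S.q_cont

theorem driven_q : DrivenBy S.t₀ S.t₁ S.u S.q :=
  DrivenBy.of_integral S.u_mem (fun j => S.continuousOn_comp_q (S.X_smooth j)) S.q_ode

theorem driven_comp_q {E : Type*} [NormedAddCommGroup E] [NormedSpace ℝ E]
    {φ : Pt n → E} (hφ : ContDiff ℝ ∞ φ) : DrivenBy S.t₀ S.t₁ S.u (fun s => φ (S.q s)) :=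
  S.driven_q.comp_contDiff (hφ.of_le (by simp))

/-- The Jacobian `∑ uⱼ DXⱼ` of the dynamics along the trajectory. -/
def jacobian (s : ℝ) : Pt n →L[ℝ] Pt n := ∑ j, S.u s j • fderiv ℝ (S.X j) (S.q s)

theorem memLp_jacobian : MemLp S.jacobian ⊤ (volume.restrict (Icc S.t₀ S.t₁)) :=
  S.u_mem.memLp_sum_smul fun j => S.continuousOn_comp_q (S.contDiff_fderiv_X j)

end SRTrajectory

namespace AdaptedFrame

variable {n k : ℕ} {S : SRTrajectory n k} (F : AdaptedFrame S)

theorem continuousOn_Φ₁_comp (j : Fin k) :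
    ContinuousOn (fun s => (F.Φ₁ s).comp (fderiv ℝ (S.X j) (S.q s))) (Icc S.t₀ S.t₁) :=
  F.Φ₁_cont.clm_comp (S.continuousOn_comp_q (S.contDiff_fderiv_X j))

theorem memLp_Φ₁_comp_jacobian :
    MemLp (fun s => (F.Φ₁ s).comp (S.jacobian s)) ⊤ (volume.restrict (Icc S.t₀ S.t₁)) := by
  refine (S.u_mem.memLp_sum_smul F.continuousOn_Φ₁_comp).ae_eq
    (Filter.Eventually.of_forall fun s => ?_)
  ext b
  simp [SRTrajectory.jacobian]

theorem Φ₁_eq_integral {t : ℝ} (ht : t ∈ Icc S.t₀ S.t₁) :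
    F.Φ₁ t = (F.L₀ : Pt n →L[ℝ] Pt n) - ∫ s in S.t₀..t, (F.Φ₁ s).comp (S.jacobian s) := by
  ext1 b
  rw [sub_apply, ContinuousLinearMap.intervalIntegral_apply
    (intervalIntegrable_of_memLp_top F.memLp_Φ₁_comp_jacobian S.t₀_mem ht), F.Φ₁_ode t ht b]
  simp [SRTrajectory.jacobian]

theorem Φ₁_initial : F.Φ₁ S.t₀ = (F.L₀ : Pt n →L[ℝ] Pt n) := by
  simpa using F.Φ₁_eq_integral S.t₀_mem

theorem driven_Φ₁ : DrivenBy S.t₀ S.t₁ S.u F.Φ₁ := by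
  refine DrivenBy.of_integral S.u_mem (fun j => (F.continuousOn_Φ₁_comp j).neg) fun s hs => ?_
  rw [F.Φ₁_eq_integral hs, F.Φ₁_initial, sub_eq_add_neg, ← intervalIntegral.integral_neg]
  congr 2
  ext σ : 1
  ext b
  simp [SRTrajectory.jacobian]

/-- Otherwise a nonzero functional `ℓ` annihilates the range of `Φ₁(t)`. The curve `ℓ ∘ Φ₁` solves a
linear equation and vanishes at time `t`, hence on all of `[t₀, t]` by backward Grönwall. This
contradicts the surjectivity of `Φ₁(t₀) = L₀`. -/
theorem Φ₁_isInvertible {t : ℝ} (ht : t ∈ Icc S.t₀ S.t₁) : (F.Φ₁ t).IsInvertible := by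
  suffices hsurj : Function.Surjective (F.Φ₁ t) by
    have hinj : Function.Injective (F.Φ₁ t : Pt n →ₗ[ℝ] Pt n) :=
      LinearMap.injective_iff_surjective.2 hsurj
    refine ⟨(LinearEquiv.ofBijective (F.Φ₁ t : Pt n →ₗ[ℝ] Pt n)
      ⟨hinj, hsurj⟩).toContinuousLinearEquiv, ?_⟩
    ext b
    rfl
  by_contra hns
  have hlt : LinearMap.range (F.Φ₁ t : Pt n →ₗ[ℝ] Pt n) < ⊤ := by
    rw [lt_top_iff_ne_top]
    exact fun h => hns (LinearMap.range_eq_top.1 h)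
  obtain ⟨l, hl0, hl⟩ := Submodule.exists_le_ker_of_lt_top _ hlt
  set ℓ : Pt n →L[ℝ] ℝ := LinearMap.toContinuousLinearMap l with hℓ
  have hsub : Icc S.t₀ t ⊆ Icc S.t₀ S.t₁ := Icc_subset_Icc_right ht.2
  have hzero : ∀ s ∈ Icc S.t₀ t, ℓ.comp (F.Φ₁ s) = 0 := by
    obtain ⟨C, hC⟩ := exists_ae_norm_le_of_memLp_top S.memLp_jacobian
    have hcont : ContinuousOn (fun s => ℓ.comp (F.Φ₁ s)) (Icc S.t₀ t) :=
      (continuousOn_const.clm_comp F.Φ₁_cont).mono hsub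
    refine eq_zero_of_norm_le_integral (C := C) hcont fun s hs => ?_
    have hpt : ℓ.comp (F.Φ₁ t) = 0 := by
      ext b
      have : F.Φ₁ t b ∈ LinearMap.ker l := hl (LinearMap.mem_range_self _ b)
      simpa [hℓ] using this
    have hdiff : F.Φ₁ s = F.Φ₁ t + ∫ σ in s..t, (F.Φ₁ σ).comp (S.jacobian σ) := by
      have h1 := intervalIntegrable_of_memLp_top F.memLp_Φ₁_comp_jacobian S.t₀_mem ht
      have h2 := intervalIntegrable_of_memLp_top F.memLp_Φ₁_comp_jacobian S.t₀_mem (hsub hs)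
      rw [← intervalIntegral.integral_interval_sub_left h1 h2, F.Φ₁_eq_integral ht,
        F.Φ₁_eq_integral (hsub hs)]
      abel
    have hps : ℓ.comp (F.Φ₁ s) = ∫ σ in s..t, (ℓ.comp (F.Φ₁ σ)).comp (S.jacobian σ) := by
      have h3 := ((ContinuousLinearMap.compL ℝ (Pt n) (Pt n) ℝ) ℓ).intervalIntegral_comp_comm
        (intervalIntegrable_of_memLp_top F.memLp_Φ₁_comp_jacobian (hsub hs) ht)
      simp only [ContinuousLinearMap.compL_apply] at h3
      rw [hdiff, ContinuousLinearMap.comp_add, hpt, zero_add, ← h3]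
      rfl
    rw [hps, ← intervalIntegral.integral_const_mul]
    refine intervalIntegral.norm_integral_le_of_norm_le hs.2 ?_ ?_
    · rw [ae_restrict_iff' measurableSet_Icc] at hC
      filter_upwards [hC] with σ hσ hσ'
      have := hσ (hsub ⟨hs.1.trans hσ'.1.le, hσ'.2⟩)
      calc _ ≤ ‖ℓ.comp (F.Φ₁ σ)‖ * ‖S.jacobian σ‖ := ContinuousLinearMap.opNorm_comp_le _ _
        _ ≤ ‖ℓ.comp (F.Φ₁ σ)‖ * C := by gcongr
        _ = _ := mul_comm _ _
    · exact (((hcont.norm.const_smul C).mono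
        (uIcc_subset_Icc hs ⟨ht.1, le_rfl⟩)).intervalIntegrable)
  apply hl0
  have h0 := hzero S.t₀ ⟨le_rfl, ht.1⟩
  rw [F.Φ₁_initial] at h0
  ext x
  have := congrArg (fun f : Pt n →L[ℝ] ℝ => f (F.L₀.symm x)) h0
  simpa [hℓ] using this

theorem driven_Φ₁_inverse : DrivenBy S.t₀ S.t₁ S.u (fun s => (F.Φ₁ s).inverse) := by
  refine F.driven_Φ₁.comp (φ := ContinuousLinearMap.inverse) fun s hs => ?_
  obtain ⟨e, he⟩ := F.Φ₁_isInvertible hs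
  rw [← he]
  exact contDiffAt_map_inverse e

/-- The coefficient of `uⱼ` in the dynamics of `-Φ₂`, symmetrized. -/
def Φ₂Coeff (j : Fin k) (s : ℝ) : Pt n →L[ℝ] Pt n →L[ℝ] Pt n :=
  symmCoeff (F.Φ₁ s) (fderiv ℝ (fderiv ℝ (S.X j)) (S.q s)) (F.Φ₂ s) (fderiv ℝ (S.X j) (S.q s))

theorem driven_Φ₂ : DrivenBy S.t₀ S.t₁ S.u F.Φ₂ :=
  DrivenBy.of_symm_of_diag S.u_mem S.t₀_lt_t₁.le F.Φ₂_symm (M := F.Φ₂Coeff)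
    (fun j => continuousOn_symmCoeff F.Φ₁_cont
      (S.continuousOn_comp_q (S.contDiff_fderiv_fderiv_X j)) F.Φ₂_cont
      (S.continuousOn_comp_q (S.contDiff_fderiv_X j)))
    (fun _ _ b b' => symmCoeff_symm _ _ _ _ b b')
    (fun t ht b => by
      rw [F.Φ₂_ode t ht b]
      simp only [Φ₂Coeff, symmCoeff_diag])

theorem driven_Y1 (i : Fin k) : DrivenBy S.t₀ S.t₁ S.u (F.Y1 i) :=
  F.driven_Φ₁.clm_apply (S.driven_comp_q (S.X_smooth i))

/-- `Yᵢ⁽²⁾(t, ·)` as a linear map. -/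
def Y2L (i : Fin k) (t : ℝ) : Pt n →L[ℝ] Pt n :=
  ((F.Φ₁ t).comp (fderiv ℝ (S.X i) (S.q t)) + F.Φ₂ t (S.X i (S.q t))).comp (F.Φ₁ t).inverse

theorem driven_Y2L (i : Fin k) : DrivenBy S.t₀ S.t₁ S.u (F.Y2L i) :=
  ((F.driven_Φ₁.clm_comp (S.driven_comp_q (S.contDiff_fderiv_X i))).add
    (F.driven_Φ₂.clm_apply (S.driven_comp_q (S.X_smooth i)))).clm_comp F.driven_Φ₁_inverse

end AdaptedFrame

/-! ### The space of controls and two variational lemmas -/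

section Controls

variable {k : ℕ} {a b : ℝ}

theorem InLinf.add {w h : ℝ → Pt k} (hw : InLinf a b w) (hh : InLinf a b h) :
    InLinf a b (w + h) := MemLp.add hw hh

theorem InLinf.smul {w : ℝ → Pt k} (hw : InLinf a b w) (c : ℝ) : InLinf a b (c • w) :=
  MemLp.const_smul hw c

/-- The space of (representatives of) controls in `L^∞([a, b], ℝᵏ)`. -/
def controls (k : ℕ) (a b : ℝ) : Submodule ℝ (ℝ → Pt k) where
  carrier := {w | InLinf a b w}
  add_mem' := fun hw hh => InLinf.add hw hh
  zero_mem' := MemLp.zero'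
  smul_mem' := fun c _ hw => InLinf.smul hw c

theorem InLinf.of_coord {w : ℝ → Pt k}
    (hw : ∀ i, MemLp (fun s => w s i) ⊤ (volume.restrict (Icc a b))) : InLinf a b w := by
  have h := memLp_finsetSum (p := ⊤) (μ := volume.restrict (Icc a b)) Finset.univ
    (f := fun i s => w s i • EuclideanSpace.single i (1 : ℝ))
    fun i _ => memLp_top_smul (hw i) (memLp_top_const _)
  refine MemLp.ae_eq (Filter.Eventually.of_forall fun s => ?_) h
  ext j
  simp [Finset.sum_apply, Pi.single_apply]

theorem InLinf.memLp_sum_mul {w : ℝ → Pt k} (hw : InLinf a b w) {g : Fin k → ℝ → ℝ}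
    (hg : ∀ i, MemLp (g i) ⊤ (volume.restrict (Icc a b))) :
    MemLp (fun s => ∑ i, w s i * g i s) ⊤ (volume.restrict (Icc a b)) :=
  memLp_finsetSum _ fun j _ => memLp_top_smul (hw.coord j) (hg j)

theorem intervalIntegrable_of_memLp_top' {E : Type*} [NormedAddCommGroup E] {f : ℝ → E}
    (hf : MemLp f ⊤ (volume.restrict (Icc a b))) {s : ℝ} (hs : s ∈ Icc a b) :
    IntervalIntegrable f volume a s :=
  intervalIntegrable_of_memLp_top hf ⟨le_rfl, hs.1.trans hs.2⟩ hs

/-- The bounded function `g` is itself an admissible test control, which gives `∫ ∑ gᵢ² = 0`. -/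
theorem ae_eq_zero_of_forall_integral_eq_zero (hab : a ≤ b) {g : Fin k → ℝ → ℝ}
    (hg : ∀ i, MemLp (g i) ⊤ (volume.restrict (Icc a b)))
    (h : ∀ w : ℝ → Pt k, InLinf a b w → ∫ s in a..b, ∑ i, w s i * g i s = 0) :
    ∀ᵐ s ∂(volume.restrict (Icc a b)), ∀ i, g i s = 0 := by
  set w : ℝ → Pt k := fun s => WithLp.toLp 2 fun i => g i s with hw_def
  have hw : InLinf a b w := InLinf.of_coord hg
  have h0 := h w hw
  have hint : Integrable (fun s => ∑ i, w s i * g i s) (volume.restrict (Icc a b)) :=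
    (hw.memLp_sum_mul hg).integrable le_top
  rw [intervalIntegral.integral_of_le hab, ← integral_Icc_eq_integral_Ioc,
    integral_eq_zero_iff_of_nonneg (fun s => Finset.sum_nonneg fun i _ => mul_self_nonneg _)
      hint] at h0
  filter_upwards [h0] with s hs i
  have := (Finset.sum_eq_zero_iff_of_nonneg fun i _ => mul_self_nonneg (g i s)).1 hs i
    (Finset.mem_univ i)
  simpa using this

end Controls

/-- For small `ε` of sign opposite to `β` the linear term would win; `ε = -β / (|γ| + 1)` is small
enough. -/
theorem eq_zero_of_forall_quadratic_nonneg {β γ : ℝ} (h : ∀ ε : ℝ, 0 ≤ ε * β + ε ^ 2 * γ) :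
    β = 0 := by
  by_contra hβ
  have hβ2 : 0 < β ^ 2 := by positivity
  set d := |γ| + 1
  have hd : 0 < d := by positivity
  have hγ : γ < d := (le_abs_self γ).trans_lt (lt_add_one _)
  have h1 := h (-β / d)
  have h2 : -β / d * β + (-β / d) ^ 2 * γ = β ^ 2 / d ^ 2 * (γ - d) := by
    field_simp
    ring
  rw [h2] at h1
  have h3 : 0 < β ^ 2 / d ^ 2 := by positivity
  nlinarith

/-! ### Linearity of the end-point map, the quadratic cost and its first variation -/

namespace AdaptedFrame

variable {n k : ℕ} {S : SRTrajectory n k} (F : AdaptedFrame S)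

/-- The linear form `x ↦ ⟨Yᵢ⁽²⁾(t, x), ψ₀⟩`. -/
def costForm (ψ₀ : Pt n →L[ℝ] ℝ) (i : Fin k) (t : ℝ) : Pt n →L[ℝ] ℝ := ψ₀.comp (F.Y2L i t)

theorem costForm_apply (ψ₀ : Pt n →L[ℝ] ℝ) (i : Fin k) (t : ℝ) (x : Pt n) :
    F.costForm ψ₀ i t x = ψ₀ (F.Y2 i t x) := rfl

theorem driven_costForm (ψ₀ : Pt n →L[ℝ] ℝ) (i : Fin k) :
    DrivenBy S.t₀ S.t₁ S.u (F.costForm ψ₀ i) :=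
  (F.driven_Y2L i).comp_contDiff (φ := fun A : Pt n →L[ℝ] Pt n => ψ₀.comp A)
    (contDiff_const.clm_comp contDiff_id)

variable {t : ℝ} (ht : t ∈ Icc S.t₀ S.t₁)

include ht

theorem continuousOn_costForm (ψ₀ : Pt n →L[ℝ] ℝ) (i : Fin k) :
    ContinuousOn (F.costForm ψ₀ i) (Icc S.t₀ t) :=
  (F.driven_costForm ψ₀ i).continuousOn.mono (Icc_subset_Icc_right ht.2)

theorem continuousOn_Y1 (i : Fin k) : ContinuousOn (F.Y1 i) (Icc S.t₀ t) :=
  (F.driven_Y1 i).continuousOn.mono (Icc_subset_Icc_right ht.2)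

theorem memLp_u (i : Fin k) : MemLp (fun s => S.u s i) ⊤ (volume.restrict (Icc S.t₀ t)) :=
  (S.u_mem.mono (Icc_subset_Icc_right ht.2)).coord i

omit ht in
theorem q1_initial (w : ℝ → Pt k) : F.q1 S.t₀ w = 0 := by simp [q1]

theorem memLp_q1_deriv {w : ℝ → Pt k} (hw : InLinf S.t₀ t w) :
    MemLp (fun s => ∑ i, w s i • F.Y1 i s) ⊤ (volume.restrict (Icc S.t₀ t)) :=
  hw.memLp_sum_smul fun i => F.continuousOn_Y1 ht i

theorem memLp_c1_deriv {w : ℝ → Pt k} (hw : InLinf S.t₀ t w) :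
    MemLp (fun s => ∑ i, w s i * S.u s i) ⊤ (volume.restrict (Icc S.t₀ t)) :=
  hw.memLp_sum_mul fun i => memLp_u ht i

theorem lipDeriv_q1 {w : ℝ → Pt k} (hw : InLinf S.t₀ t w) :
    LipDeriv S.t₀ t (fun s => F.q1 s w) (fun s => ∑ i, w s i • F.Y1 i s) :=
  LipDeriv.of_integral (F.memLp_q1_deriv ht hw) fun s _ => by
    rw [F.q1_initial, zero_add, q1]

theorem q1_add_smul {w h : ℝ → Pt k} (hw : InLinf S.t₀ t w) (hh : InLinf S.t₀ t h) (c : ℝ)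
    {s : ℝ} (hs : s ∈ Icc S.t₀ t) : F.q1 s (w + c • h) = F.q1 s w + c • F.q1 s h := by
  have h1 := intervalIntegrable_of_memLp_top' (F.memLp_q1_deriv ht hw) hs
  have h2 : IntervalIntegrable (fun σ => c • ∑ i, h σ i • F.Y1 i σ) volume S.t₀ s :=
    (intervalIntegrable_of_memLp_top' (F.memLp_q1_deriv ht hh) hs).smul c
  rw [q1, q1, q1, ← intervalIntegral.integral_smul, ← intervalIntegral.integral_add h1 h2]
  congr 1
  ext1 σ
  simp [add_smul, Finset.sum_add_distrib, Finset.smul_sum, smul_smul]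

theorem c1_add_smul {w h : ℝ → Pt k} (hw : InLinf S.t₀ t w) (hh : InLinf S.t₀ t h) (c : ℝ)
    {s : ℝ} (hs : s ∈ Icc S.t₀ t) : F.c1 s (w + c • h) = F.c1 s w + c * F.c1 s h := by
  have h1 := intervalIntegrable_of_memLp_top' (memLp_c1_deriv ht hw) hs
  have h2 := intervalIntegrable_of_memLp_top' (memLp_c1_deriv ht hh) hs
  rw [c1, c1, c1, ← intervalIntegral.integral_const_mul,
    ← intervalIntegral.integral_add h1 (h2.const_mul c)]
  congr 1
  ext1 σ
  simp [add_mul, Finset.sum_add_distrib, Finset.mul_sum, mul_assoc]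

theorem qq1_add_smul {w h : ℝ → Pt k} (hw : InLinf S.t₀ t w) (hh : InLinf S.t₀ t h) (c : ℝ)
    {s : ℝ} (hs : s ∈ Icc S.t₀ t) : F.qq1 s (w + c • h) = F.qq1 s w + c • F.qq1 s h := by
  rw [qq1, F.q1_add_smul ht hw hh c hs, F.c1_add_smul ht hw hh c hs]
  rfl

/-- The end-point map `w ↦ (q⁽¹⁾, c⁽¹⁾)(t, w)` as a linear map. -/
def endpoint : controls k S.t₀ t →ₗ[ℝ] Pt n × ℝ where
  toFun w := F.qq1 t w
  map_add' w h := by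
    simpa using F.qq1_add_smul ht w.2 h.2 1 ⟨ht.1, le_rfl⟩
  map_smul' c w := by
    have h0 : F.qq1 t (0 : ℝ → Pt k) = 0 := by simp [qq1, q1, c1]
    simpa [h0] using F.qq1_add_smul ht (controls k S.t₀ t).zero_mem w.2 c ⟨ht.1, le_rfl⟩

theorem memLp_costForm (ψ₀ : Pt n →L[ℝ] ℝ) {w h : ℝ → Pt k} (hw : InLinf S.t₀ t w)
    (hh : InLinf S.t₀ t h) :
    MemLp (fun s => ∑ i, w s i * F.costForm ψ₀ i s (F.q1 s h)) ⊤
      (volume.restrict (Icc S.t₀ t)) :=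
  hw.memLp_sum_mul fun i => memLp_top_of_continuousOn
    ((F.continuousOn_costForm ht ψ₀ i).clm_apply (F.lipDeriv_q1 ht hh).continuousOn)

theorem cost_eq (ψ₀ : Pt n →L[ℝ] ℝ) {w : ℝ → Pt k} (hw : InLinf S.t₀ t w) :
    F.cost ψ₀ t w = ∫ s in S.t₀..t, ∑ i, w s i * F.costForm ψ₀ i s (F.q1 s w) := by
  have hm : MemLp (fun s => ∑ i, w s i • F.Y2 i s (F.q1 s w)) ⊤ (volume.restrict (Icc S.t₀ t)) :=
    hw.memLp_sum_smul fun i => ((F.driven_Y2L i).continuousOn.mono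
      (Icc_subset_Icc_right ht.2)).clm_apply (F.lipDeriv_q1 ht hw).continuousOn
  rw [cost, q2, ← ψ₀.intervalIntegral_comp_comm
    (intervalIntegrable_of_memLp_top' hm ⟨ht.1, le_rfl⟩)]
  simp [costForm_apply]

omit ht in
/-- Twice the polar form of the cost. -/
def costPolar (ψ₀ : Pt n →L[ℝ] ℝ) (t : ℝ) (w h : ℝ → Pt k) : ℝ :=
  (∫ s in S.t₀..t, ∑ i, w s i * F.costForm ψ₀ i s (F.q1 s h)) +
    ∫ s in S.t₀..t, ∑ i, h s i * F.costForm ψ₀ i s (F.q1 s w)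

theorem cost_add_smul (ψ₀ : Pt n →L[ℝ] ℝ) {w h : ℝ → Pt k} (hw : InLinf S.t₀ t w)
    (hh : InLinf S.t₀ t h) (c : ℝ) :
    F.cost ψ₀ t (w + c • h) =
      F.cost ψ₀ t w + c * F.costPolar ψ₀ t w h + c ^ 2 * F.cost ψ₀ t h := by
  have hI : ∀ {w h : ℝ → Pt k}, InLinf S.t₀ t w → InLinf S.t₀ t h → IntervalIntegrable
      (fun s => ∑ i, w s i * F.costForm ψ₀ i s (F.q1 s h)) volume S.t₀ t := fun hw hh =>
    intervalIntegrable_of_memLp_top' (F.memLp_costForm ht ψ₀ hw hh) ⟨ht.1, le_rfl⟩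
  rw [F.cost_eq ht ψ₀ (hw.add (hh.smul c)), F.cost_eq ht ψ₀ hw, F.cost_eq ht ψ₀ hh, costPolar,
    ← intervalIntegral.integral_add (hI hw hh) (hI hh hw),
    ← intervalIntegral.integral_const_mul, ← intervalIntegral.integral_const_mul,
    ← intervalIntegral.integral_add (hI hw hw) (((hI hw hh).add (hI hh hw)).const_mul c),
    ← intervalIntegral.integral_add ((hI hw hw).add (((hI hw hh).add (hI hh hw)).const_mul c))
      ((hI hh hh).const_mul _)]
  apply intervalIntegral.integral_congr
  intro s hs
  rw [uIcc_of_le ht.1] at hs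
  simp only [F.q1_add_smul ht hw hh c hs, map_add, map_smul, Pi.add_apply, Pi.smul_apply,
    PiLp.add_apply, PiLp.smul_apply, smul_eq_mul, Finset.mul_sum, ← Finset.sum_add_distrib]
  refine Finset.sum_congr rfl fun i _ => ?_
  ring

theorem costPolar_add_smul (ψ₀ : Pt n →L[ℝ] ℝ) {w h h' : ℝ → Pt k} (hw : InLinf S.t₀ t w)
    (hh : InLinf S.t₀ t h) (hh' : InLinf S.t₀ t h') (c : ℝ) :
    F.costPolar ψ₀ t w (h + c • h') = F.costPolar ψ₀ t w h + c * F.costPolar ψ₀ t w h' := by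
  have hI : ∀ {w h : ℝ → Pt k}, InLinf S.t₀ t w → InLinf S.t₀ t h → IntervalIntegrable
      (fun s => ∑ i, w s i * F.costForm ψ₀ i s (F.q1 s h)) volume S.t₀ t := fun hw hh =>
    intervalIntegrable_of_memLp_top' (F.memLp_costForm ht ψ₀ hw hh) ⟨ht.1, le_rfl⟩
  have hh2 := hh.add (hh'.smul c)
  rw [costPolar, costPolar, costPolar,
    ← intervalIntegral.integral_add (hI hw hh2) (hI hh2 hw),
    ← intervalIntegral.integral_add (hI hw hh) (hI hh hw),
    ← intervalIntegral.integral_add (hI hw hh') (hI hh' hw),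
    ← intervalIntegral.integral_const_mul,
    ← intervalIntegral.integral_add ((hI hw hh).add (hI hh hw))
      (((hI hw hh').add (hI hh' hw)).const_mul c)]
  apply intervalIntegral.integral_congr
  intro s hs
  rw [uIcc_of_le ht.1] at hs
  simp only [F.q1_add_smul ht hh hh' c hs, map_add, map_smul, Pi.add_apply, Pi.smul_apply,
    PiLp.add_apply, PiLp.smul_apply, smul_eq_mul, Finset.mul_sum, ← Finset.sum_add_distrib]
  refine Finset.sum_congr rfl fun i _ => ?_
  ring

/-- The first variation of the cost at `w` as a linear map. -/
def costDifferential (ψ₀ : Pt n →L[ℝ] ℝ) {w : ℝ → Pt k} (hw : InLinf S.t₀ t w) :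
    controls k S.t₀ t →ₗ[ℝ] ℝ where
  toFun h := F.costPolar ψ₀ t w h
  map_add' h h' := by
    simpa using F.costPolar_add_smul ht ψ₀ hw h.2 h'.2 1
  map_smul' c h := by
    have h0 : F.costPolar ψ₀ t w (0 : ℝ → Pt k) = 0 := by
      simp [costPolar, q1]
    simpa [h0] using F.costPolar_add_smul ht ψ₀ hw (controls k S.t₀ t).zero_mem h.2 c

/-- The first variation of the cost in terms of a solution `ψ` of the adjoint equation. -/
theorem costPolar_eq_of_adjoint (ψ₀ : Pt n →L[ℝ] ℝ) {w h : ℝ → Pt k} (hw : InLinf S.t₀ t w)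
    (hh : InLinf S.t₀ t h) {ψ : ℝ → Pt n →L[ℝ] ℝ}
    (hψ : LipDeriv S.t₀ t ψ (fun s => ∑ j, w s j • F.costForm ψ₀ j s)) :
    F.costPolar ψ₀ t w h = ψ t (F.q1 t h) + ∫ s in S.t₀..t, ∑ i, h s i *
      (F.costForm ψ₀ i s (F.q1 s w) - ψ s (F.Y1 i s)) := by
  have htt : t ∈ Icc S.t₀ t := ⟨ht.1, le_rfl⟩
  -- Integration by parts: the derivative of `ψ(q⁽¹⁾(h))` contains the first integrand of
  -- `costPolar` plus `∑ hᵢ ψ(Yᵢ⁽¹⁾)`.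
  have h1 := (hψ.clm_apply (F.lipDeriv_q1 ht hh)).integral_eq htt
  rw [F.q1_initial, map_zero, sub_zero] at h1
  have hI1 := intervalIntegrable_of_memLp_top' (F.memLp_costForm ht ψ₀ hw hh) htt
  have hI2 := intervalIntegrable_of_memLp_top' (F.memLp_costForm ht ψ₀ hh hw) htt
  have hI3 : IntervalIntegrable (fun s => ∑ i, h s i * ψ s (F.Y1 i s)) volume S.t₀ t :=
    intervalIntegrable_of_memLp_top' (hh.memLp_sum_mul fun i => memLp_top_of_continuousOn
      (hψ.continuousOn.clm_apply (F.continuousOn_Y1 ht i))) htt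
  rw [← h1, costPolar]
  simp only [mul_sub, Finset.sum_sub_distrib, sum_apply, smul_apply, map_sum, map_smul,
    smul_eq_mul]
  rw [intervalIntegral.integral_add hI1 hI3, intervalIntegral.integral_sub hI2 hI3]
  ring

/-- If the first variation of the cost factors through the end-point map, then there is a covector
curve satisfying the adjoint equation and the stationarity condition. -/
theorem exists_covector (ψ₀ : Pt n →L[ℝ] ℝ) {w : ℝ → Pt k} (hw : InLinf S.t₀ t w)
    (η : Pt n →L[ℝ] ℝ) (a : ℝ)
    (h : ∀ h, InLinf S.t₀ t h → F.costPolar ψ₀ t w h = η (F.q1 t h) + a * F.c1 t h) :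
    ∃ ψ : ℝ → Pt n →L[ℝ] ℝ,
      (∀ s ∈ Icc S.t₀ t, ψ s = ψ S.t₀ + ∫ σ in S.t₀..s, ∑ j, w σ j • F.costForm ψ₀ j σ) ∧
      LipDeriv S.t₀ t ψ (fun s => ∑ j, w s j • F.costForm ψ₀ j s) ∧
      ∀ᵐ s ∂(volume.restrict (Icc S.t₀ t)), ∀ i,
        F.costForm ψ₀ i s (F.q1 s w) - ψ s (F.Y1 i s) = a * S.u s i := by
  have htt : t ∈ Icc S.t₀ t := ⟨ht.1, le_rfl⟩
  set I : ℝ → Pt n →L[ℝ] ℝ := fun s => ∫ σ in S.t₀..s, ∑ j, w σ j • F.costForm ψ₀ j σ with hI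
  have hm : MemLp (fun σ => ∑ j, w σ j • F.costForm ψ₀ j σ) ⊤ (volume.restrict (Icc S.t₀ t)) :=
    hw.memLp_sum_smul fun j => F.continuousOn_costForm ht ψ₀ j
  -- The constant is chosen so that `ψ t = η`; the boundary term of the first variation then cancels
  -- `η (q⁽¹⁾(t, h))`.
  set ψ : ℝ → Pt n →L[ℝ] ℝ := fun s => (η - I t) + I s with hψ_def
  have hψ : ∀ s ∈ Icc S.t₀ t,
      ψ s = ψ S.t₀ + ∫ σ in S.t₀..s, ∑ j, w σ j • F.costForm ψ₀ j σ := fun s _ => by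
    simp [hψ_def, hI]
  have hψL := LipDeriv.of_integral hm hψ
  refine ⟨ψ, hψ, hψL, ?_⟩
  have hmg : ∀ i, MemLp (fun s => F.costForm ψ₀ i s (F.q1 s w) - ψ s (F.Y1 i s)) ⊤
      (volume.restrict (Icc S.t₀ t)) := fun i => memLp_top_of_continuousOn
    (((F.continuousOn_costForm ht ψ₀ i).clm_apply (F.lipDeriv_q1 ht hw).continuousOn).sub
      (hψL.continuousOn.clm_apply (F.continuousOn_Y1 ht i)))
  have hma : ∀ i, MemLp (fun s => a * S.u s i) ⊤ (volume.restrict (Icc S.t₀ t)) := fun i =>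
    (memLp_u ht i).const_mul a
  have key := ae_eq_zero_of_forall_integral_eq_zero ht.1 (fun i => (hmg i).sub (hma i))
    fun h' hh' => ?_
  · filter_upwards [key] with s hs i
    exact sub_eq_zero.1 (hs i)
  · have h1 := h h' hh'
    rw [F.costPolar_eq_of_adjoint ht ψ₀ hw hh' hψL] at h1
    have h2 : ψ t = η := by simp [hψ_def]
    rw [h2, add_right_inj, c1, ← intervalIntegral.integral_const_mul] at h1
    simp only [Pi.sub_apply, mul_sub, Finset.sum_sub_distrib] at h1 ⊢
    have hI1 := intervalIntegrable_of_memLp_top' (hh'.memLp_sum_mul hmg) htt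
    have hI2 := intervalIntegrable_of_memLp_top' (hh'.memLp_sum_mul hma) htt
    simp only [mul_sub, Finset.sum_sub_distrib] at hI1
    rw [intervalIntegral.integral_sub hI1 hI2, h1, sub_eq_zero]
    congr 1
    ext1 σ
    rw [Finset.mul_sum]
    exact Finset.sum_congr rfl fun i _ => by ring

end AdaptedFrame

/-! ### Gain of one derivative by integration -/

section Regularity

variable {E : Type*} [NormedAddCommGroup E] [NormedSpace ℝ E] [CompleteSpace E] {a b : ℝ}

theorem contDiffOn_succ_of_eq_integral (hab : a < b) {f g : ℝ → E} {m : ℕ}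
    (hg : ContDiffOn ℝ m g (Icc a b))
    (h : ∀ s ∈ Icc a b, f s = f a + ∫ σ in a..s, g σ) : ContDiffOn ℝ (m + 1 : ℕ) f (Icc a b) := by
  have hd : ∀ s ∈ Icc a b, HasDerivWithinAt f (g s) (Icc a b) s := by
    intro s hs
    -- Provides the instance for the one-sided fundamental theorem of calculus within `Icc a b`.
    have : Fact (s ∈ Icc a b) := ⟨hs⟩
    have hi : IntervalIntegrable g volume a s :=
      (hg.continuousOn.mono (uIcc_subset_Icc ⟨le_rfl, hab.le⟩ hs)).intervalIntegrable
    have h1 := (intervalIntegral.integral_hasDerivWithinAt_right hi (s := Icc a b) (t := Icc a b)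
      ⟨Icc a b, self_mem_nhdsWithin, hg.continuousOn.aestronglyMeasurable measurableSet_Icc⟩
      (hg.continuousOn s hs)).const_add (f a)
    exact h1.congr h (h s hs)
  have hu := uniqueDiffOn_Icc hab
  rw [Nat.cast_add, Nat.cast_one, contDiffOn_succ_iff_derivWithin hu]
  refine ⟨fun s hs => (hd s hs).differentiableWithinAt, by simp, ?_⟩
  exact hg.congr fun s hs => (hd s hs).derivWithin (hu s hs)

end Regularity

/-! ### Solutions and normal extremals, the Goh condition, and `C²` regularity -/

namespace AdaptedFrame

variable {n k : ℕ} {S : SRTrajectory n k} (F : AdaptedFrame S)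

theorem hamiltonian_eq (ψ₀ : Pt n →L[ℝ] ℝ) (s : ℝ) (x : Pt n × ℝ) (ψ : Pt n →L[ℝ] ℝ) (a : ℝ)
    (z : Pt k) : F.hamiltonian ψ₀ (-1) s x ψ a z =
      ∑ i, z i * (ψ (F.Y1 i s) + a * S.u s i - F.costForm ψ₀ i s x.1) := by
  simp only [hamiltonian, map_sum, map_smul, smul_eq_mul, Finset.mul_sum, costForm_apply,
    ← Finset.sum_add_distrib]
  exact Finset.sum_congr rfl fun i _ => by ring

theorem fderiv_hamiltonian (ψ₀ : Pt n →L[ℝ] ℝ) (s : ℝ) (ψ : Pt n →L[ℝ] ℝ) (a : ℝ)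
    (z : Pt k) (x v : Pt n × ℝ) :
    fderiv ℝ (fun x => F.hamiltonian ψ₀ (-1) s x ψ a z) x v =
      -(∑ i, z i • F.costForm ψ₀ i s) v.1 := by
  have h : (fun x => F.hamiltonian ψ₀ (-1) s x ψ a z) = fun x : Pt n × ℝ =>
      (∑ i, z i * (ψ (F.Y1 i s) + a * S.u s i)) -
        ((∑ i, z i • F.costForm ψ₀ i s).comp (ContinuousLinearMap.fst ℝ (Pt n) ℝ)) x := by
    ext x
    rw [hamiltonian_eq]
    simp [mul_sub, Finset.sum_sub_distrib, sum_apply]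
  rw [h, fderiv_const_sub, ContinuousLinearMap.fderiv]
  rfl

variable {t : ℝ} (ht : t ∈ Icc S.t₀ S.t₁)

include ht

theorem costPolar_eq_zero_of_isSolution {ψ₀ : Pt n →L[ℝ] ℝ} {w h : ℝ → Pt k}
    (hw : F.IsSolution ψ₀ t w) (hh : InLinf S.t₀ t h) (h0 : F.qq1 t h = 0) :
    F.costPolar ψ₀ t w h = 0 := by
  refine eq_zero_of_forall_quadratic_nonneg (γ := F.cost ψ₀ t h) fun ε => ?_
  have h1 := hw.2 (w + ε • h) (hw.1.add (hh.smul ε)) (by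
    rw [F.qq1_add_smul ht hw.1 hh ε ⟨ht.1, le_rfl⟩, h0, smul_zero, add_zero])
  rw [F.cost_add_smul ht ψ₀ hw.1 hh ε] at h1
  linarith

theorem isNormalExtremal_of_costPolar_eq {ψ₀ : Pt n →L[ℝ] ℝ} {w : ℝ → Pt k}
    (hw : InLinf S.t₀ t w)
    (h : ∀ h, InLinf S.t₀ t h → F.qq1 t h = 0 → F.costPolar ψ₀ t w h = 0) :
    F.IsNormalExtremal ψ₀ t w := by
  -- Lagrange multiplier: a functional vanishing on the kernel of a linear map factors through that
  -- map.
  obtain ⟨l, hl⟩ : F.costDifferential ht ψ₀ hw ∈ LinearMap.range (F.endpoint ht).dualMap := by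
    rw [LinearMap.range_dualMap_eq_dualAnnihilator_ker, Submodule.mem_dualAnnihilator]
    exact fun h' hh' => h h' h'.2 hh'
  have hl' : ∀ h, InLinf S.t₀ t h → F.costPolar ψ₀ t w h =
      (LinearMap.toContinuousLinearMap (l ∘ₗ LinearMap.inl ℝ (Pt n) ℝ)) (F.q1 t h) +
        l (0, 1) * F.c1 t h := fun h' hh' => by
    have h1 : l (F.qq1 t h') = F.costPolar ψ₀ t w h' :=
      congrArg (fun f => f (⟨h', hh'⟩ : controls k S.t₀ t)) hl
    have h2 : F.qq1 t h' = (F.q1 t h', 0) + F.c1 t h' • ((0 : Pt n), (1 : ℝ)) := by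
      simp [qq1]
    rw [← h1, h2, map_add, map_smul, smul_eq_mul, mul_comm]
    rfl
  obtain ⟨ψ, hψ, hψL, hst⟩ := F.exists_covector ht ψ₀ hw _ _ hl'
  refine ⟨ψ, fun _ => l (0, 1), hw, fun s hs v => ?_, ?_, fun s _ h0 => by simp at h0⟩
  · have hm : MemLp (fun σ => ∑ j, w σ j • F.costForm ψ₀ j σ) ⊤
        (volume.restrict (Icc S.t₀ t)) :=
      hw.memLp_sum_smul fun j => F.continuousOn_costForm ht ψ₀ j
    simp only [fderiv_hamiltonian]
    rw [intervalIntegral.integral_neg, ← ContinuousLinearMap.intervalIntegral_apply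
      (intervalIntegrable_of_memLp_top' hm hs), hψ s hs, add_apply, sub_neg_eq_add]
    exact add_right_comm _ _ _
  · filter_upwards [hst] with s hs z
    have h0 : ∀ i, ψ s (F.Y1 i s) + l (0, 1) * S.u s i - F.costForm ψ₀ i s (F.qq1 s w).1 = 0 :=
      fun i => by
        rw [← hs i]
        simp [qq1]
    simp [hamiltonian_eq, h0]

theorem costPolar_eq_zero_of_isNormalExtremal {ψ₀ : Pt n →L[ℝ] ℝ} {w h : ℝ → Pt k}
    (hw : F.IsNormalExtremal ψ₀ t w) (hh : InLinf S.t₀ t h) (h0 : F.qq1 t h = 0) :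
    F.costPolar ψ₀ t w h = 0 := by
  obtain ⟨ψ, a, hp⟩ := hw
  have htt : t ∈ Icc S.t₀ t := ⟨ht.1, le_rfl⟩
  have hm : MemLp (fun σ => ∑ j, w σ j • F.costForm ψ₀ j σ) ⊤ (volume.restrict (Icc S.t₀ t)) :=
    hp.mem.memLp_sum_smul fun j => F.continuousOn_costForm ht ψ₀ j
  -- The Hamiltonian does not depend on `c`, so `a` is constant.
  have ha : ∀ s ∈ Icc S.t₀ t, a s = a S.t₀ := fun s hs => by
    simpa [fderiv_hamiltonian] using hp.adjoint s hs (0, 1)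
  have hψ : LipDeriv S.t₀ t ψ (fun s => ∑ j, w s j • F.costForm ψ₀ j s) := by
    refine LipDeriv.of_integral hm fun s hs => ?_
    ext x
    have := hp.adjoint s hs (x, 0)
    simp only [fderiv_hamiltonian, mul_zero, add_zero] at this
    rw [this, add_apply, ContinuousLinearMap.intervalIntegral_apply
      (intervalIntegrable_of_memLp_top' hm hs), intervalIntegral.integral_neg, sub_neg_eq_add]
  rw [F.costPolar_eq_of_adjoint ht ψ₀ hp.mem hh hψ]
  have hq : F.q1 t h = 0 := congrArg Prod.fst h0
  have hc : F.c1 t h = 0 := congrArg Prod.snd h0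
  have hint : ∫ s in S.t₀..t, ∑ i, h s i *
      (F.costForm ψ₀ i s (F.q1 s w) - ψ s (F.Y1 i s)) = a S.t₀ * F.c1 t h := by
    rw [c1, ← intervalIntegral.integral_const_mul]
    apply intervalIntegral.integral_congr_ae
    have hmax := hp.maximum
    rw [ae_restrict_iff' measurableSet_Icc] at hmax
    filter_upwards [hmax] with s hs hs'
    rw [uIoc_of_le ht.1] at hs'
    have hsI : s ∈ Icc S.t₀ t := Ioc_subset_Icc_self hs'
    rw [Finset.mul_sum]
    refine Finset.sum_congr rfl fun i _ => ?_
    have h1 : ψ s (F.Y1 i s) + a s * S.u s i - F.costForm ψ₀ i s (F.q1 s w) = 0 := by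
      set r := ψ s (F.Y1 i s) + a s * S.u s i - F.costForm ψ₀ i s (F.q1 s w) with hr
      -- Moving the control by `r` in direction `i` raises the Hamiltonian by `r²`, so maximality
      -- forces `r = 0`.
      have h2 := hs hsI (w s + EuclideanSpace.single i r)
      simp only [hamiltonian_eq, PiLp.add_apply, add_mul, Finset.sum_add_distrib] at h2
      have h3 : ∑ j, (EuclideanSpace.single i r : Pt k) j * (ψ s (F.Y1 j s) + a s * S.u s j -
          F.costForm ψ₀ j s (F.qq1 s w).1) = r * r := by
        rw [Finset.sum_eq_single i]
        · simp [hr, qq1]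
        · intro j _ hj
          simp [hj]
        · simp
      rw [h3] at h2
      exact mul_self_eq_zero.1 (le_antisymm (by linarith) (mul_self_nonneg r))
    rw [ha s hsI] at h1
    have h4 : F.costForm ψ₀ i s (F.q1 s w) - ψ s (F.Y1 i s) = a S.t₀ * S.u s i := by linarith
    rw [h4]
    ring
  rw [hint, hq, hc, map_zero, mul_zero, add_zero]

theorem cost_nonneg_of_Qmin_ne_bot {ψ₀ : Pt n →L[ℝ] ℝ} (hQ : F.Qmin ψ₀ t 0 ≠ ⊥)
    {h : ℝ → Pt k} (hh : InLinf S.t₀ t h) (h0 : F.qq1 t h = 0) : 0 ≤ F.cost ψ₀ t h := by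
  by_contra! hneg
  have hz : InLinf S.t₀ t (0 : ℝ → Pt k) := (controls k S.t₀ t).zero_mem
  apply hQ
  rw [Qmin, sInf_eq_bot]
  intro b hb
  obtain ⟨r, -, hr⟩ := EReal.lt_iff_exists_real_btwn.1 hb
  -- With this choice `c ≥ 1` and `c · cost = cost - |r|`, so the rescaled control has cost `c² ·
  -- cost ≤ cost - |r| < r`.
  set c := |r| / (-F.cost ψ₀ t h) + 1 with hc
  have hpos : 0 < -F.cost ψ₀ t h := by linarith
  refine ⟨_, ⟨(0 : ℝ → Pt k) + c • h, ⟨hz.add (hh.smul c), ?_⟩, rfl⟩, lt_trans ?_ hr⟩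
  · rw [F.qq1_add_smul ht hz hh c ⟨ht.1, le_rfl⟩, h0]
    simp [qq1, q1, c1]
  · have h1 : F.cost ψ₀ t ((0 : ℝ → Pt k) + c • h) = c ^ 2 * F.cost ψ₀ t h := by
      rw [F.cost_add_smul ht ψ₀ hz hh c]
      simp [costPolar, cost, q1, q2]
    have h2 : c * (-F.cost ψ₀ t h) = |r| + -F.cost ψ₀ t h := by
      rw [hc, add_mul, div_mul_cancel₀ _ hpos.ne', one_mul]
    have h3 : 1 ≤ c := by
      rw [hc]
      linarith [div_nonneg (abs_nonneg r) hpos.le]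
    have h4 := neg_abs_le r
    have h5 : 0 ≤ (c - 1) * (c * (-F.cost ψ₀ t h)) :=
      mul_nonneg (by linarith) (mul_nonneg (by linarith) hpos.le)
    simp only [h1]
    exact_mod_cast (by linarith : c ^ 2 * F.cost ψ₀ t h < r)

theorem isSolution_iff_isNormalExtremal {ψ₀ : Pt n →L[ℝ] ℝ} (hQ : F.Qmin ψ₀ t 0 ≠ ⊥)
    {w : ℝ → Pt k} (hw : InLinf S.t₀ t w) :
    F.IsSolution ψ₀ t w ↔ F.IsNormalExtremal ψ₀ t w := by
  refine ⟨fun h => F.isNormalExtremal_of_costPolar_eq ht hw fun h' hh' h0 =>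
    F.costPolar_eq_zero_of_isSolution ht h hh' h0, fun h => ⟨hw, fun w' hw' hqq => ?_⟩⟩
  set d : ℝ → Pt k := w' + (-1 : ℝ) • w with hd_def
  have hd : InLinf S.t₀ t d := hw'.add (hw.smul _)
  have hd0 : F.qq1 t d = 0 := by
    rw [F.qq1_add_smul ht hw' hw _ ⟨ht.1, le_rfl⟩, hqq]
    simp
  have hw'_eq : w' = w + (1 : ℝ) • d := by
    simp [hd_def]
  rw [hw'_eq, F.cost_add_smul ht ψ₀ hw hd, F.costPolar_eq_zero_of_isNormalExtremal ht h hd hd0]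
  have := F.cost_nonneg_of_Qmin_ne_bot ht hQ hd hd0
  linarith

/-- For `s > t₀` the vectors `Yⱼ⁽¹⁾(s)` belong to the projection of the reachable set. -/
theorem exists_mem_reach_fst_eq_Y1 (hlt : S.t₀ < t) (j : Fin k) :
    ∃ v ∈ F.reach t, v.1 = F.Y1 j t := by
  have htt : t ∈ Icc S.t₀ t := ⟨ht.1, le_rfl⟩
  by_contra! hcon
  set p : Submodule ℝ (Pt n) :=
    LinearMap.range (LinearMap.fst ℝ (Pt n) ℝ ∘ₗ F.endpoint ht) with hp
  have hnot : F.Y1 j t ∉ p := by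
    rintro ⟨w, hw⟩
    exact hcon (F.qq1 t w) ⟨w, w.2, rfl⟩ hw
  obtain ⟨l, hl, hpl⟩ := Submodule.exists_le_ker_of_notMem hnot
  set ℓ : Pt n →L[ℝ] ℝ := LinearMap.toContinuousLinearMap l with hℓ
  have hcont : ContinuousOn (fun s => ℓ (F.Y1 j s)) (Icc S.t₀ t) :=
    ℓ.continuous.comp_continuousOn (F.continuousOn_Y1 ht j)
  -- A functional `ℓ` killing all reachable points but not `Yⱼ⁽¹⁾(t)` is tested on the control
  -- `ℓ(Yⱼ⁽¹⁾) eⱼ`. It gives `∫ ℓ(Yⱼ⁽¹⁾)² = 0`, although this continuous integrand is positive at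
  -- `t`.
  set w : ℝ → Pt k := fun s => EuclideanSpace.single j (ℓ (F.Y1 j s)) with hw_def
  have hw : InLinf S.t₀ t w := by
    refine InLinf.of_coord fun i => ?_
    by_cases hij : i = j
    · subst hij
      simpa [hw_def] using memLp_top_of_continuousOn hcont
    · simp [hw_def, hij]
  have h1 : ℓ (F.q1 t w) = 0 := by
    have : F.q1 t w ∈ LinearMap.ker l := hpl ⟨⟨w, hw⟩, rfl⟩
    simpa [hℓ] using this
  rw [q1, ← ℓ.intervalIntegral_comp_comm
    (intervalIntegrable_of_memLp_top' (F.memLp_q1_deriv ht hw) htt)] at h1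
  have h2 : ∀ s, ℓ (∑ i, w s i • F.Y1 i s) = ℓ (F.Y1 j s) * ℓ (F.Y1 j s) := fun s => by
    rw [map_sum, Finset.sum_eq_single j]
    · simp [hw_def]
    · intro i _ hi
      simp [hw_def, hi]
    · simp
  simp only [h2] at h1
  have h3 : 0 < ∫ s in S.t₀..t, ℓ (F.Y1 j s) * ℓ (F.Y1 j s) :=
    intervalIntegral.integral_pos hlt (hcont.mul hcont) (fun _ _ => mul_self_nonneg _)
      ⟨t, htt, mul_self_pos.2 hl⟩
  linarith

/-- The Goh condition: the bilinear form `⟨Yᵢ⁽²⁾(s, Yⱼ⁽¹⁾), ψ₀⟩` is symmetric. -/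
theorem SecondOrderConditions.goh {ψ₀ : Pt n →L[ℝ] ℝ}
    {Ψ₂ : ℝ → Pt n →L[ℝ] Pt n →L[ℝ] ℝ} {ζ : ℝ → Pt n →L[ℝ] ℝ} {a₂ : ℝ → ℝ}
    (h : F.SecondOrderConditions ψ₀ Ψ₂ ζ a₂) :
    ∀ᵐ s ∂(volume.restrict (Icc S.t₀ t)), ∀ i j,
      F.costForm ψ₀ i s (F.Y1 j s) = F.costForm ψ₀ j s (F.Y1 i s) := by
  have hsub : Icc S.t₀ t ⊆ Icc S.t₀ S.t₁ := Icc_subset_Icc_right ht.2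
  have hne : ∀ᵐ s ∂(volume.restrict (Icc S.t₀ t)), s ≠ S.t₀ :=
    ae_restrict_of_ae (Measure.ae_ne volume S.t₀)
  filter_upwards [ae_restrict_of_ae_restrict_of_subset hsub h.eq_first,
    ae_restrict_of_ae_restrict_of_subset hsub h.eq_second, hne,
    ae_restrict_mem measurableSet_Icc] with s h1 h2 hs hsI i j
  have hlt : S.t₀ < s := lt_of_le_of_ne hsI.1 hs.symm
  -- Apply `eq_first` at a reachable point over `Yⱼ⁽¹⁾` and eliminate `ζ(Yⱼ⁽¹⁾)` by `eq_second`; the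
  -- result is symmetric in `i, j`.
  have key : ∀ i j, F.costForm ψ₀ i s (F.Y1 j s) =
      2 * Ψ₂ s (F.Y1 j s) (F.Y1 i s) - 2 * a₂ s * S.u s j * S.u s i := fun i j => by
    obtain ⟨v, hv, hvY⟩ := F.exists_mem_reach_fst_eq_Y1 (hsub hsI) hlt j
    have h3 := h1 i v hv
    have h4 := h2 j
    rw [hvY] at h3
    rw [costForm_apply]
    linear_combination h3 + S.u s i * h4
  rw [key i j, key j i, h.symm s (hsub hsI) (F.Y1 j s)]
  ring

/-- The cost minus the quadratic form at the end-point is nonnegative on all controls and at most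
zero at `w`, so its first variation at `w` vanishes. -/
theorem SecondOrderConditions.costPolar_eq {ψ₀ : Pt n →L[ℝ] ℝ}
    {Ψ₂ : ℝ → Pt n →L[ℝ] Pt n →L[ℝ] ℝ} {ζ : ℝ → Pt n →L[ℝ] ℝ} {a₂ : ℝ → ℝ}
    (hs : F.SecondOrderConditions ψ₀ Ψ₂ ζ a₂) {w h : ℝ → Pt k} (hw : F.IsSolution ψ₀ t w)
    (hh : InLinf S.t₀ t h) :
    F.costPolar ψ₀ t w h =
      ((2 : ℝ) • Ψ₂ t (F.q1 t w) + F.c1 t w • ζ t) (F.q1 t h) +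
        (ζ t (F.q1 t w) + 2 * a₂ t * F.c1 t w) * F.c1 t h := by
  have hle : ∀ w', InLinf S.t₀ t w' → quad (Ψ₂ t) (ζ t) (a₂ t) (F.qq1 t w') ≤ F.cost ψ₀ t w' := by
    intro w' hw'
    have h1 := hs.value t ht (F.qq1 t w') ⟨w', hw', rfl⟩
    have h2 : F.Qmin ψ₀ t (F.qq1 t w') ≤ (F.cost ψ₀ t w' : EReal) :=
      sInf_le ⟨w', ⟨hw', rfl⟩, rfl⟩
    rw [h1] at h2
    exact_mod_cast h2
  have hge : F.cost ψ₀ t w ≤ quad (Ψ₂ t) (ζ t) (a₂ t) (F.qq1 t w) := by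
    have h1 := hs.value t ht (F.qq1 t w) ⟨w, hw.1, rfl⟩
    have h2 : (F.cost ψ₀ t w : EReal) ≤ F.Qmin ψ₀ t (F.qq1 t w) := by
      refine le_sInf ?_
      rintro _ ⟨w', ⟨hw', hqq⟩, rfl⟩
      exact EReal.coe_le_coe_iff.2 (hw.2 w' hw' hqq)
    rw [h1] at h2
    exact_mod_cast h2
  rw [← sub_eq_zero]
  refine eq_zero_of_forall_quadratic_nonneg
    (γ := F.cost ψ₀ t h - quad (Ψ₂ t) (ζ t) (a₂ t) (F.qq1 t h)) fun ε => ?_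
  have h1 := hle (w + ε • h) (hw.1.add (hh.smul ε))
  rw [F.qq1_add_smul ht hw.1 hh ε ⟨ht.1, le_rfl⟩, F.cost_add_smul ht ψ₀ hw.1 hh] at h1
  simp only [quad, qq1, Prod.fst_add, Prod.smul_fst, Prod.snd_add, Prod.smul_snd, map_add,
    map_smul, add_apply, smul_apply, smul_eq_mul] at h1 hge ⊢
  have h2 := hs.symm t ht (F.q1 t h) (F.q1 t w)
  rw [h2] at h1
  linarith

theorem contDiffOn_two_of_isSolution {ψ₀ : Pt n →L[ℝ] ℝ}
    {Ψ₂ : ℝ → Pt n →L[ℝ] Pt n →L[ℝ] ℝ} {ζ : ℝ → Pt n →L[ℝ] ℝ} {a₂ : ℝ → ℝ}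
    (hs : F.SecondOrderConditions ψ₀ Ψ₂ ζ a₂) {w : ℝ → Pt k} (hw : F.IsSolution ψ₀ t w)
    (hm : ζ t (F.q1 t w) + 2 * a₂ t * F.c1 t w ≠ 0) : ContDiffOn ℝ 2 S.q (Icc S.t₀ t) := by
  have hsub : Icc S.t₀ t ⊆ Icc S.t₀ S.t₁ := Icc_subset_Icc_right ht.2
  have hlt : S.t₀ < t := by
    refine lt_of_le_of_ne ht.1 fun h => hm ?_
    rw [← h]
    simp [q1, c1]
  obtain ⟨ψ, -, hψ, hst⟩ := F.exists_covector ht ψ₀ hw.1 _ _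
    fun h hh => hs.costPolar_eq F ht hw hh
  set m := ζ t (F.q1 t w) + 2 * a₂ t * F.c1 t w
  choose G hG hGL using fun i => (F.driven_costForm ψ₀ i).mono hsub
  choose K hK hKL using fun i => (F.driven_Y1 i).mono hsub
  have hx := F.lipDeriv_q1 ht hw.1
  set f : Fin k → ℝ → ℝ := fun i s => F.costForm ψ₀ i s (F.q1 s w) - ψ s (F.Y1 i s) with hf_def
  have hfc : ∀ i, ContinuousOn (f i) (Icc S.t₀ t) := fun i =>
    (((hGL i).clm_apply hx).sub (hψ.clm_apply (hKL i))).continuousOn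
  have hu : ∀ᵐ s ∂(volume.restrict (Icc S.t₀ t)), ∀ j, S.u s j = m⁻¹ * f j s := by
    filter_upwards [hst] with s hs j
    rw [hf_def]
    simp only [hs j]
    field_simp
  -- The `w`-terms of the derivative cancel by the Goh condition, and `u` is replaced by `m⁻¹ f`;
  -- the right side is now continuous.
  have hf : ∀ i, LipDeriv S.t₀ t (f i)
      (fun s => ∑ j, (m⁻¹ * f j s) * (G i j s (F.q1 s w) - ψ s (K i j s))) := fun i => by
    refine (((hGL i).clm_apply hx).sub (hψ.clm_apply (hKL i))).congr_deriv ?_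
    filter_upwards [hu, SecondOrderConditions.goh F ht hs] with s hus hgoh
    simp only [sum_apply, smul_apply, map_sum, map_smul, smul_eq_mul, ← hus, mul_sub,
      Finset.sum_sub_distrib, hgoh i]
    ring_nf
  have hfC : ∀ i, ContDiffOn ℝ 1 (f i) (Icc S.t₀ t) := fun i => by
    have hg : ContDiffOn ℝ (0 : ℕ)
        (fun s => ∑ j, (m⁻¹ * f j s) * (G i j s (F.q1 s w) - ψ s (K i j s))) (Icc S.t₀ t) := by
      rw [Nat.cast_zero, contDiffOn_zero]
      exact continuousOn_finsetSum _ fun j _ => (continuousOn_const.mul (hfc j)).mul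
        (((hG i j).clm_apply hx.continuousOn).sub (hψ.continuousOn.clm_apply (hK i j)))
    have := contDiffOn_succ_of_eq_integral hlt hg fun s hs => by
      rw [(hf i).integral_eq hs]
      exact (add_sub_cancel _ _).symm
    simpa using this
  have hq : ∀ s ∈ Icc S.t₀ t,
      S.q s = S.q S.t₀ + ∫ σ in S.t₀..s, ∑ i, (m⁻¹ * f i σ) • S.X i (S.q σ) := fun s hs => by
    rw [S.q_ode s (hsub hs)]
    congr 1
    apply intervalIntegral.integral_congr_ae
    rw [ae_restrict_iff' measurableSet_Icc] at hu
    filter_upwards [hu] with σ hσ hσ'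
    rw [uIoc_of_le hs.1] at hσ'
    simp only [hσ ⟨hσ'.1.le, hσ'.2.trans hs.2⟩]
  -- Bootstrap: the control `m⁻¹ f` is `C¹`, so each of the two passes through the integral equation
  -- gains one derivative of `q`.
  have step : ∀ N : ℕ, N ≤ 1 → ContDiffOn ℝ N S.q (Icc S.t₀ t) →
      ContDiffOn ℝ (N + 1 : ℕ) S.q (Icc S.t₀ t) := fun N hN hqN =>
    contDiffOn_succ_of_eq_integral hlt (ContDiffOn.sum fun i _ =>
      (contDiffOn_const.mul ((hfC i).of_le (by exact_mod_cast hN))).smul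
        (((S.X_smooth i).of_le (by exact_mod_cast le_top)).comp_contDiffOn hqN)) hq
  have h1 := step 0 zero_le_one (by simpa using S.q_cont.mono hsub)
  exact_mod_cast step 1 le_rfl h1

end AdaptedFrame

end SubRiem

end

theorem lemma4p20 {n k : ℕ} (S : SubRiem.SRTrajectory n k) (F : SubRiem.AdaptedFrame S)
    (hS : F.IsStrictlyAbnormal)
    (ψ₀ : SubRiem.Pt n →L[ℝ] ℝ) (t : ℝ) (ht : t ∈ Set.Icc S.t₀ S.t₁) :
    ((F.Qmin ψ₀ t 0 ≠ ⊥ ∧ F.Qmin ψ₀ t 0 ≠ ⊤) →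
      ∀ w : ℝ → SubRiem.Pt k, SubRiem.InLinf S.t₀ t w →
        (F.IsSolution ψ₀ t w ↔ F.IsNormalExtremal ψ₀ t w)) ∧
    (∀ (Ψ₂ : ℝ → SubRiem.Pt n →L[ℝ] SubRiem.Pt n →L[ℝ] ℝ) (ζ : ℝ → SubRiem.Pt n →L[ℝ] ℝ)
      (a₂ : ℝ → ℝ), F.SecondOrderConditions ψ₀ Ψ₂ ζ a₂ →
      ∀ w : ℝ → SubRiem.Pt k, F.IsSolution ψ₀ t w →
        ζ t (F.q1 t w) + 2 * a₂ t * F.c1 t w ≠ 0 →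
        ContDiffOn ℝ 2 S.q (Set.Icc S.t₀ t)) :=
  ⟨fun hQ _ hw => F.isSolution_iff_isNormalExtremal ht hQ.1 hw,
    fun _ _ _ hs _ hw hm => F.contDiffOn_two_of_isSolution ht hs hw hm⟩
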